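/- \textbf{Theorem (Slice Theorem).} We work in the category of compactly generated spaces: a space is a Hausdorff space in which a subset is closed as soon as its intersection with every compact subset is closed, products $Y\times Z$ carry the $k$-ification of the classical product topology, and continuity of group multiplications and actions refers to these products. Subgroups are closed. An open subset $U$ of a space $B$ is \emph{quasi-regular} if every $b\in U$ has an open neighborhood whose closure in $B$ is contained in $U$. For a topological group $G$ and a subgroup $H\subseteq G$, the pair $(G,H)$ \emph{satisfies Condition (S)} if there are a quasi-regular open neighborhood $U$ of $1H$ in $G/H$ and a continuous map $\sigma\colon U\to G$ with $\mathrm{pr}\circ\sigma=\mathrm{id}_U$, where $\mathrm{pr}\colon G\to G/H$ is the projection. A \emph{$G$-$CW$-complex} is a $G$-space $X$ with a filtration $\emptyset=X_{-1}\subseteq X_0\subseteq X_1\subseteq\cdots$ by closed $G$-subspaces with union $X$ such that $X=\operatorname{colim}_n X_n$ and, for every $n\ge 0$, $X_n$ is a $G$-pushout of $X_{n-1}$ and $\coprod_{i\in I_n}G/H_i\times D^n$ along $\coprod_{i\in I_n}G/H_i\times S^{n-1}$ for some closed subgroups $H_i\subseteq G$. Let $G$ be a (compactly generated) topological group and let $X$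 be a $G$-$CW$-complex. Let $x\in X$ with isotropy group $G_x$, and let $V_x$ be a $G_x$-invariant neighborhood of $x$. Suppose that the pair $(G,G_x)$ satisfies Condition (S). Then there exists a $G_x$-invariant subset $S_x\subseteq X$ containing $x$ with the following properties: \begin{enumerate} \item[(i)] $S_x$ with the (classical) subspace topology is compactly generated; \item[(ii)] the closure of $S_x$ in $X$ is contained in $V_x$; \item[(iii)] the inclusion $\{x\}\to S_x$ is a $G_x$-homotopy equivalence; \item[(iv)] the set $U:=G\cdot S_x$ is a quasi-regular $G$-invariant open subset of $X$, and the map \[ G\times_{G_x}S_x\to U,\qquad (g,s)\mapsto g\cdot s \] is a $G$-homeomorphism, where $G\times_{G_x}S_x$ is the quotient of $G\times S_x$ by the relation $(g,s)\sim(gh^{-1},hs)$ for $h\in G_x$, with $G$ acting by $g_0\cdot(g,s)=(g_0g,s)$. \end{enumerate} -/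

import Mathlib

open Topology

universe u v w

/-! ### Groups and actions in the category of compactly generated spaces

A space is compactly generated if it is Hausdorff and a subset is closed as soon as its
intersection with every compact subset is closed; in Mathlib: `T2Space` together with
`CompactlyGeneratedSpace`. Products are formed in this category, so the product of `Y` and `Z` is
the k-ification `CompactCoherentification (Y × Z)` of the classical product. -/

/-- The group structure on `G` is continuous for the compactly generated product `k (G × G)`.
Every classical topological group has this property. -/
class IsKGroup (G : Type u) [Group G] [TopologicalSpace G] : Prop where
  continuous_mul : Continuous fun p : CompactCoherentification (G × G) =>
    ((CompactCoherentification.mk (G × G)).symm p).1 *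
      ((CompactCoherentification.mk (G × G)).symm p).2
  continuous_inv : Continuous fun g : G => g⁻¹

/-- The action of `G` on `X` is continuous for the compactly generated product `k (G × X)`. -/
class ContinuousKSMul (G : Type u) (X : Type v) [Group G] [TopologicalSpace G]
    [TopologicalSpace X] [MulAction G X] : Prop where
  continuous_smul : Continuous fun p : CompactCoherentification (G × X) =>
    ((CompactCoherentification.mk (G × X)).symm p).1 •
      ((CompactCoherentification.mk (G × X)).symm p).2

/-! ### Quasi-regular open sets and Condition (S) -/

/-- `U` is open, and every point of `U` has an open neighborhood whose closure in `B` is contained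
in `U`. -/
def IsQuasiRegularOpen {B : Type u} [TopologicalSpace B] (U : Set B) : Prop :=
  IsOpen U ∧ ∀ b ∈ U, ∃ W : Set B, IsOpen W ∧ b ∈ W ∧ closure W ⊆ U

/-- The pair `(G, H)` satisfies Condition (S): the projection `G → G ⧸ H` has a continuous local
section over some quasi-regular open neighborhood of `1H`. -/
def ConditionS {G : Type u} [Group G] [TopologicalSpace G] (H : Subgroup G) : Prop :=
  ∃ U : Set (G ⧸ H), IsQuasiRegularOpen U ∧ ((1 : G) : G ⧸ H) ∈ U ∧
    ∃ σ : U → G, Continuous σ ∧ ∀ y : U, (σ y : G ⧸ H) = y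

/-! ### Equivariant CW-complexes -/

/-- The closed unit ball `D^n`. Its boundary sphere `S^(n-1)` is the set where the norm is `1`;
for `n = 0` the ball is a point and the sphere is empty. -/
abbrev UnitDisk (n : ℕ) : Type := Metric.closedBall (0 : EuclideanSpace ℝ (Fin n)) 1

/-- The structure of a `G`-CW-complex on a `G`-space `X`: a filtration
`∅ = X_{-1} ⊆ X_0 ⊆ X_1 ⊆ ⋯` by closed subspaces with union `X` such that `X` has the colimit
topology and, for every `n`, the space `X_n` is a `G`-pushout of `X_{n-1}` and
`∐ i, G ⧸ H i × D^n` along `∐ i, G ⧸ H i × S^(n-1)`, where the `H i` are closed subgroups.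
To include `X_{-1}`, the index is shifted: `skel n` is the skeleton `X_{n-1}`.

The pushout is spelled out: as a set, `X_n` is the disjoint union of `X_{n-1}` and the open cells
`G ⧸ H i × (D^n ∖ S^(n-1))` (`bijOn_charMap`), with the boundaries of the cells attached to
`X_{n-1}` (`charMap_mem_skel`), and it carries the final topology with respect to the inclusion of
`X_{n-1}` and the characteristic maps (`isClosed_of_subset_skel`). The skeleta are `G`-invariant
because the characteristic maps are equivariant. -/
structure GCWComplex (G : Type u) (X : Type v) [Group G] [TopologicalSpace G]
    [TopologicalSpace X] [MulAction G X] where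
  /-- The index set of the equivariant `n`-cells. -/
  cell : ℕ → Type w
  /-- The subgroup `H` of an equivariant cell `G ⧸ H × D^n`. -/
  isotropy : (n : ℕ) → cell n → Subgroup G
  isClosed_isotropy : ∀ n i, IsClosed (isotropy n i : Set G)
  /-- The characteristic map of an equivariant cell. -/
  charMap : (n : ℕ) → (i : cell n) → (G ⧸ isotropy n i) × UnitDisk n → X
  continuous_charMap : ∀ n i, Continuous (charMap n i)
  charMap_smul : ∀ n i (g : G) (a : G ⧸ isotropy n i) (z : UnitDisk n),
    charMap n i (g • a, z) = g • charMap n i (a, z)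
  /-- `skel n` is the `(n - 1)`-skeleton. -/
  skel : ℕ → Set X
  skel_zero : skel 0 = ∅
  skel_subset_succ : ∀ n, skel n ⊆ skel (n + 1)
  isClosed_skel : ∀ n, IsClosed (skel n)
  charMap_mem_skel : ∀ n i (a : G ⧸ isotropy n i) (z : UnitDisk n),
    ‖(z : EuclideanSpace ℝ (Fin n))‖ = 1 → charMap n i (a, z) ∈ skel n
  bijOn_charMap : ∀ n, Set.BijOn
    (fun p : Σ i : cell n, (G ⧸ isotropy n i) × UnitDisk n => charMap n p.1 p.2)
    {p | ‖(p.2.2 : EuclideanSpace ℝ (Fin n))‖ < 1} (skel (n + 1) \ skel n)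
  isClosed_of_subset_skel : ∀ n (A : Set X), A ⊆ skel (n + 1) → IsClosed (A ∩ skel n) →
    (∀ i, IsClosed (charMap n i ⁻¹' A)) → IsClosed A
  iUnion_skel : ⋃ n, skel n = Set.univ
  isClosed_of_inter_skel : ∀ A : Set X, (∀ n, IsClosed (A ∩ skel n)) → IsClosed A

/-! ### Equivariant homotopy equivalences -/

/-- The continuous map `f` is equivariant. -/
def IsGMap (H : Type u) {A : Type v} {B : Type w} [Group H] [TopologicalSpace A]
    [TopologicalSpace B] [MulAction H A] [MulAction H B] (f : C(A, B)) : Prop :=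
  ∀ (h : H) (a : A), f (h • a) = h • f a

/-- There is a homotopy from `f₀` to `f₁` through equivariant maps. -/
def GHomotopic (H : Type u) {A : Type v} {B : Type w} [Group H] [TopologicalSpace A]
    [TopologicalSpace B] [MulAction H A] [MulAction H B] (f₀ f₁ : C(A, B)) : Prop :=
  ∃ F : ContinuousMap.Homotopy f₀ f₁, ∀ (t : unitInterval) (h : H) (a : A),
    F (t, h • a) = h • F (t, a)

/-- The map `f` is an `H`-homotopy equivalence. -/
def IsGHomotopyEquiv (H : Type u) {A : Type v} {B : Type w} [Group H] [TopologicalSpace A]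
    [TopologicalSpace B] [MulAction H A] [MulAction H B] (f : C(A, B)) : Prop :=
  IsGMap H f ∧ ∃ k : C(B, A), IsGMap H k ∧
    GHomotopic H (k.comp f) (ContinuousMap.id A) ∧ GHomotopic H (f.comp k) (ContinuousMap.id B)

/-- The one-point subset `{x}` with the action of the isotropy group of `x`. -/
def stabilizerPoint (G : Type u) {X : Type v} [Group G] [MulAction G X] (x : X) :
    SubMulAction (MulAction.stabilizer G x) X where
  carrier := {x}
  smul_mem' h y hy := by
    rw [Set.mem_singleton_iff] at hy ⊢
    subst hy
    exact h.2

/-- The inclusion `{x} → S`. -/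
def pointInclusion {G : Type u} {X : Type v} [Group G] [MulAction G X] [TopologicalSpace X]
    {x : X} (S : SubMulAction (MulAction.stabilizer G x) X) (hx : x ∈ S) :
    C(stabilizerPoint G x, S) where
  toFun y := ⟨y, by
    have hy : (y : X) = x := y.2
    rw [hy]
    exact hx⟩
  continuous_toFun := by fun_prop

/-! ### The balanced product `G ×_H S` -/

/-- The relation `(g, s) ∼ (g h⁻¹, h s)` for `h ∈ H`, on the compactly generated product
`k (G × S)`. -/
def balancedSetoid {G : Type u} [Group G] (H : Subgroup G) (S : Type v) [MulAction H S] :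
    Setoid (CompactCoherentification (G × S)) where
  r p q := ∃ h : H,
    ((CompactCoherentification.mk (G × S)).symm q).1 =
        ((CompactCoherentification.mk (G × S)).symm p).1 * (h : G)⁻¹ ∧
      ((CompactCoherentification.mk (G × S)).symm q).2 =
        h • ((CompactCoherentification.mk (G × S)).symm p).2
  iseqv :=
    { refl := fun p => ⟨1, by simp, by simp⟩
      symm := by
        rintro p q ⟨h, h₁, h₂⟩
        exact ⟨h⁻¹, by simp [h₁], by simp [h₂]⟩
      trans := by
        rintro p q r ⟨h, h₁, h₂⟩ ⟨k, k₁, k₂⟩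
        exact ⟨k * h, by simp [h₁, k₁, mul_assoc], by simp [h₂, k₂, mul_smul]⟩ }

/-- `G ×_H S`, with the quotient topology of `k (G × S)`. -/
def BalancedProduct {G : Type u} [Group G] (H : Subgroup G) (S : Type v) [MulAction H S] :
    Type (max u v) :=
  Quotient (balancedSetoid H S)

namespace BalancedProduct

instance {G : Type u} [Group G] [TopologicalSpace G] (H : Subgroup G) (S : Type v)
    [TopologicalSpace S] [MulAction H S] : TopologicalSpace (BalancedProduct H S) :=
  inferInstanceAs (TopologicalSpace (Quotient (balancedSetoid H S)))

/-- The class of `(g, s)` in `G ×_H S`. -/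
noncomputable def mk {G : Type u} [Group G] (H : Subgroup G) {S : Type v} [MulAction H S] (g : G) (s : S) :
    BalancedProduct H S :=
  Quotient.mk (balancedSetoid H S) (CompactCoherentification.mk (G × S) (g, s))

/-- The left action `g₀ • (g, s) = (g₀ g, s)` of `G` on `G ×_H S`. -/
noncomputable instance {G : Type u} [Group G] (H : Subgroup G) (S : Type v) [MulAction H S] :
    SMul G (BalancedProduct H S) where
  smul g₀ := Quotient.lift
    (fun p => mk H (g₀ * ((CompactCoherentification.mk (G × S)).symm p).1)
      ((CompactCoherentification.mk (G × S)).symm p).2)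
    (by
      rintro p q ⟨h, h₁, h₂⟩
      refine Quotient.sound ⟨h, ?_, ?_⟩
      · simp [h₁, mul_assoc]
      · simp [h₂])

end BalancedProduct

/-- The subset `G · S` of `X`. -/
def saturation (G : Type u) {X : Type v} [Group G] [MulAction G X] (S : Set X) : Set X :=
  {y | ∃ g : G, ∃ s ∈ S, g • s = y}

/-! ### Compactly generated spaces -/

/-! The slice is a fiber of an equivariant retraction onto the orbit of `x`. Behind it stands a tube
(`IsTube`): a continuous invariant gauge with values in `[0, 2]` and, on the closed set where the
gauge is at most 1, an equivariant flow whose time-one map lands in the orbit. `S` consists of the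
points of gauge less than 1 that flow to `x`. The flow contracts `S` to `x`, and the gauge levels
below 1 give quasi-regularity of `G · S` and compact generation of `S`.

Orbits are closed and homogeneous (`isClosedEmbedding_orbit`), so the time-one map becomes a
continuous equivariant map `R` from `G · S = {gauge < 1}` to `G ⧸ G_x` with fiber `S` over the base
coset. Lifting `R` locally to `τ` with values in `G`, by translates of the section from Condition
(S), gives the local inverse `y ↦ [τ y, (τ y)⁻¹ y]` of `G ×_{G_x} S → G · S`.

The tube starts as a small ball in the open cell through `x` (`exists_tube_open_cell`) and is
extended one skeleton at a time (`exists_tube_succ`): points in a collar of a new cell move radially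
to the boundary and then follow the old flow. Old values are kept, so the colimit topology glues the
stages (`exists_tube`). The delicate point is to keep the closure of `S` in `V`, since `G ⧸ H ×
S^(m-1)` need not be compact. A single collar width per cell still suffices (`exists_collar`), by
compactness of the sphere and invariance of `V` under `G_x`.

The flow takes values in `C(ℝ, X)`, so that the pushout and colimit properties are applied to maps
out of `X` itself rather than out of a product of `X` with an interval. -/

theorem IsKGroup.separatelyContinuousMul (G : Type u) [Group G] [TopologicalSpace G] [T2Space G]
    [CompactlyGeneratedSpace G] [IsKGroup G] : SeparatelyContinuousMul G where
  continuous_const_mul {g} := (IsKGroup.continuous_mul (G := G)).comp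
    ((CompactCoherentification.continuous_map_of_continuous
      (f := fun a : G => (g, a)) (by fun_prop)).comp CompactCoherentification.continuous_mk)
  continuous_mul_const {g} := (IsKGroup.continuous_mul (G := G)).comp
    ((CompactCoherentification.continuous_map_of_continuous
      (f := fun a : G => (a, g)) (by fun_prop)).comp CompactCoherentification.continuous_mk)

/-- On a compactly generated space, continuity into the k-product may be tested in the classical
product. -/
theorem Continuous.compactCoherentification_mk {Y : Type u} {Z : Type v} [TopologicalSpace Y]
    [CompactlyCoherentSpace Y] [TopologicalSpace Z] {f : Y → Z} (hf : Continuous f) :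
    Continuous fun y => CompactCoherentification.mk Z (f y) :=
  (CompactCoherentification.continuous_map_of_continuous hf).comp
    CompactCoherentification.continuous_mk

/-- The action is continuous only for the k-product, so the source must be compactly coherent. This
is why compact generation of subspaces has to be established below. -/
theorem Continuous.kSMul {G : Type u} {X : Type v} {Y : Type w} [Group G] [TopologicalSpace G]
    [TopologicalSpace X] [MulAction G X] [ContinuousKSMul G X] [TopologicalSpace Y]
    [CompactlyCoherentSpace Y] {f : Y → G} {k : Y → X} (hf : Continuous f) (hk : Continuous k) :
    Continuous fun y => f y • k y :=
  (ContinuousKSMul.continuous_smul (G := G) (X := X)).comp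
    (hf.prodMk hk).compactCoherentification_mk

theorem ContinuousKSMul.continuousConstSMul (G : Type u) (X : Type v) [Group G]
    [TopologicalSpace G] [TopologicalSpace X] [T2Space X] [CompactlyGeneratedSpace X]
    [MulAction G X] [ContinuousKSMul G X] : ContinuousConstSMul G X where
  continuous_const_smul _ := continuous_const.kSMul continuous_id

/-- A subset of a compactly generated space is compactly generated if each of its points has a
neighborhood in it that is closed in the whole space. -/
theorem compactlyGeneratedSpace_subtype {X : Type u} [TopologicalSpace X] [T2Space X]
    [CompactlyGeneratedSpace X] {A : Set X}
    (hA : ∀ a ∈ A, ∃ W F : Set X, IsOpen W ∧ a ∈ W ∧ IsClosed F ∧ F ⊆ A ∧ W ∩ A ⊆ F) :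
    CompactlyGeneratedSpace A := by
  refine compactlyGeneratedSpace_of_isClosed_of_t2 fun B hB => ?_
  rw [← isOpen_compl_iff, isOpen_iff_mem_nhds]
  rintro ⟨a, ha⟩ haB
  obtain ⟨W, F, hW, haW, hF, hFA, hWF⟩ := hA a ha
  -- For compact `K`, the set `K ∩ F` is a compact subset of `A`, so the hypothesis on `B` applies
  -- to it.
  have hBF : IsClosed ((Subtype.val '' B) ∩ F) := by
    refine CompactlyGeneratedSpace.isClosed fun K hK => ?_
    have hKF : IsCompact (K ∩ F) := hK.inter_right hF
    have hK' : IsCompact (Subtype.val ⁻¹' (K ∩ F) : Set A) := by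
      rw [Subtype.isCompact_iff, Subtype.image_preimage_coe,
        Set.inter_eq_right.2 (Set.inter_subset_right.trans hFA)]
      exact hKF
    have := (hK'.inter_left (hB _ hK')).image continuous_subtype_val
    convert this.isClosed using 1
    ext y
    simp only [Set.mem_inter_iff, Set.mem_image, Subtype.exists, Set.mem_preimage]
    constructor
    · rintro ⟨⟨⟨z, hz, hzB, rfl⟩, h⟩, h'⟩
      exact ⟨z, hz, ⟨⟨hzB, h', h⟩, h', h⟩, rfl⟩
    · rintro ⟨z, hz, ⟨⟨hzB, h', h⟩, _⟩, rfl⟩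
      exact ⟨⟨⟨z, hz, hzB, rfl⟩, h⟩, h'⟩
  have : (Subtype.val ⁻¹' (W ∩ ((Subtype.val '' B) ∩ F)ᶜ) : Set A) ∈ 𝓝 (⟨a, ha⟩ : A) := by
    refine ((hW.inter hBF.isOpen_compl).preimage continuous_subtype_val).mem_nhds ⟨haW, ?_⟩
    rintro ⟨⟨b, hb, rfl⟩, -⟩
    exact haB hb
  filter_upwards [this] with b hb hbB
  exact hb.2 ⟨⟨b, hbB, rfl⟩, hWF ⟨hb.1, b.2⟩⟩

/-! ### The radial structure of the disk -/

namespace UnitDisk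

variable {n : ℕ}

theorem norm_le_one (w : UnitDisk n) : ‖(w : EuclideanSpace ℝ (Fin n))‖ ≤ 1 :=
  mem_closedBall_zero_iff.1 w.2

/-- The radial retraction of Euclidean space onto the disk. -/
noncomputable def retract (v : EuclideanSpace ℝ (Fin n)) : UnitDisk n :=
  ⟨(max 1 ‖v‖)⁻¹ • v, by
    have h : 0 < max 1 ‖v‖ := lt_max_of_lt_left one_pos
    rw [mem_closedBall_zero_iff, norm_smul, norm_inv, Real.norm_of_nonneg h.le,
      inv_mul_le_iff₀ h, mul_one]
    exact le_max_right _ _⟩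

@[fun_prop]
theorem continuous_retract : Continuous (retract (n := n)) := by
  refine Continuous.subtype_mk (Continuous.smul ((continuous_const.max continuous_norm).inv₀ fun v => ?_)
    continuous_id) _
  exact (lt_max_of_lt_left one_pos).ne'

theorem coe_retract {v : EuclideanSpace ℝ (Fin n)} (hv : ‖v‖ ≤ 1) :
    (retract v : EuclideanSpace ℝ (Fin n)) = v := by
  simp [retract, max_eq_left hv]

theorem retract_coe (w : UnitDisk n) : retract (w : EuclideanSpace ℝ (Fin n)) = w :=
  Subtype.ext (coe_retract w.norm_le_one)

/-- The radial projection of the outer half of the disk onto the sphere, continuously extended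
to the disk. -/
noncomputable def bd (w : UnitDisk n) : UnitDisk n :=
  retract ((2 : ℝ) • (w : EuclideanSpace ℝ (Fin n)))

@[fun_prop]
theorem continuous_bd : Continuous (bd (n := n)) := by
  unfold bd
  fun_prop

/-- The point at distance `s` from the center in the direction of `u`. -/
noncomputable def radial (s : ℝ) (u : UnitDisk n) : UnitDisk n :=
  retract (s • (u : EuclideanSpace ℝ (Fin n)))

@[fun_prop]
theorem continuous_radial {Y : Type*} [TopologicalSpace Y] {s : Y → ℝ} {u : Y → UnitDisk n}
    (hs : Continuous s) (hu : Continuous u) : Continuous fun y => radial (s y) (u y) := by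
  unfold radial
  fun_prop

/-- Doubling moves the outer half of the disk to norm at least 1, where `retract` normalizes. -/
theorem coe_bd {w : UnitDisk n} (hw : 1 / 2 ≤ ‖(w : EuclideanSpace ℝ (Fin n))‖) :
    (bd w : EuclideanSpace ℝ (Fin n)) =
      ‖(w : EuclideanSpace ℝ (Fin n))‖⁻¹ • (w : EuclideanSpace ℝ (Fin n)) := by
  have h : (1 : ℝ) ≤ 2 * ‖(w : EuclideanSpace ℝ (Fin n))‖ := by linarith
  have h0 : ‖(w : EuclideanSpace ℝ (Fin n))‖ ≠ 0 := by linarith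
  simp only [bd, retract, norm_smul, Real.norm_ofNat, max_eq_right h, smul_smul]
  congr 1
  field_simp

theorem norm_bd {w : UnitDisk n} (hw : 1 / 2 ≤ ‖(w : EuclideanSpace ℝ (Fin n))‖) :
    ‖(bd w : EuclideanSpace ℝ (Fin n))‖ = 1 := by
  rw [coe_bd hw, norm_smul, norm_inv, norm_norm, inv_mul_cancel₀]
  linarith

theorem radial_norm_bd {w : UnitDisk n} (hw : 1 / 2 ≤ ‖(w : EuclideanSpace ℝ (Fin n))‖) :
    radial ‖(w : EuclideanSpace ℝ (Fin n))‖ (bd w) = w := by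
  rw [radial, coe_bd hw, smul_smul, mul_inv_cancel₀ (by linarith), one_smul, retract_coe]

theorem radial_one (u : UnitDisk n) : radial 1 u = u := by
  rw [radial, one_smul, retract_coe]

theorem bd_eq_self {w : UnitDisk n} (hw : ‖(w : EuclideanSpace ℝ (Fin n))‖ = 1) : bd w = w := by
  refine Subtype.ext ?_
  rw [coe_bd (by linarith), hw, inv_one, one_smul]

theorem norm_radial {u : UnitDisk n} (hu : ‖(u : EuclideanSpace ℝ (Fin n))‖ = 1) {s : ℝ}
    (hs0 : 0 ≤ s) (hs : s ≤ 1) : ‖(radial s u : EuclideanSpace ℝ (Fin n))‖ = s := by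
  have : ‖s • (u : EuclideanSpace ℝ (Fin n))‖ = s := by
    rw [norm_smul, hu, mul_one, Real.norm_of_nonneg hs0]
  rw [radial, coe_retract (this.trans_le hs), this]

theorem bd_radial {u : UnitDisk n} (hu : ‖(u : EuclideanSpace ℝ (Fin n))‖ = 1) {s : ℝ}
    (hs0 : 1 / 2 ≤ s) (hs : s ≤ 1) : bd (radial s u) = u := by
  have h1 := norm_radial hu (by linarith : 0 ≤ s) hs
  refine Subtype.ext ?_
  have : ‖s • (u : EuclideanSpace ℝ (Fin n))‖ = s := by
    rw [norm_smul, hu, mul_one, Real.norm_of_nonneg (by linarith)]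
  rw [coe_bd (by linarith), h1, radial, coe_retract (this.trans_le hs), smul_smul,
    inv_mul_cancel₀ (by linarith), one_smul]

end UnitDisk

/-! ### Maps out of an equivariant CW-complex -/

namespace GCWComplex

variable {G : Type u} {X : Type v} [Group G] [TopologicalSpace G] [TopologicalSpace X]
  [MulAction G X] (C : GCWComplex.{u, v, w} G X)

theorem skel_mono {m n : ℕ} (h : m ≤ n) : C.skel m ⊆ C.skel n :=
  monotone_nat_of_le_succ C.skel_subset_succ h

theorem charMap_mem_skel_succ (n : ℕ) (i : C.cell n) (a : G ⧸ C.isotropy n i) (z : UnitDisk n) :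
    C.charMap n i (a, z) ∈ C.skel (n + 1) := by
  rcases z.norm_le_one.lt_or_eq with h | h
  · exact ((C.bijOn_charMap n).mapsTo (x := ⟨i, a, z⟩) h).1
  · exact C.skel_subset_succ n (C.charMap_mem_skel n i a z h)

theorem charMap_notMem_skel {n : ℕ} {i : C.cell n} {a : G ⧸ C.isotropy n i} {z : UnitDisk n}
    (h : ‖(z : EuclideanSpace ℝ (Fin n))‖ < 1) : C.charMap n i (a, z) ∉ C.skel n :=
  ((C.bijOn_charMap n).mapsTo (x := ⟨i, a, z⟩) h).2

theorem charMap_injective {n : ℕ} {i j : C.cell n} {a : G ⧸ C.isotropy n i}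
    {b : G ⧸ C.isotropy n j} {z w : UnitDisk n}
    (hz : ‖(z : EuclideanSpace ℝ (Fin n))‖ < 1) (hw : ‖(w : EuclideanSpace ℝ (Fin n))‖ < 1)
    (h : C.charMap n i (a, z) = C.charMap n j (b, w)) :
    i = j ∧ a ≍ b ∧ z = w := by
  have hz' : (⟨i, a, z⟩ : Σ i : C.cell n, (G ⧸ C.isotropy n i) × UnitDisk n) ∈
      {p | ‖(p.2.2 : EuclideanSpace ℝ (Fin n))‖ < 1} := hz
  have hw' : (⟨j, b, w⟩ : Σ i : C.cell n, (G ⧸ C.isotropy n i) × UnitDisk n) ∈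
      {p | ‖(p.2.2 : EuclideanSpace ℝ (Fin n))‖ < 1} := hw
  have := (C.bijOn_charMap n).injOn hz' hw' h
  rw [Sigma.mk.injEq] at this
  obtain ⟨rfl, h'⟩ := this
  rw [heq_eq_eq, Prod.mk.injEq] at h'
  exact ⟨rfl, heq_of_eq h'.1, h'.2⟩

theorem charMap_injective' {n : ℕ} {i : C.cell n} {a b : G ⧸ C.isotropy n i} {z w : UnitDisk n}
    (hz : ‖(z : EuclideanSpace ℝ (Fin n))‖ < 1) (hw : ‖(w : EuclideanSpace ℝ (Fin n))‖ < 1)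
    (h : C.charMap n i (a, z) = C.charMap n i (b, w)) : a = b ∧ z = w :=
  (C.charMap_injective hz hw h).2.imp_left eq_of_heq

theorem exists_charMap_eq {n : ℕ} {y : X} (hy : y ∈ C.skel (n + 1)) (hy' : y ∉ C.skel n) :
    ∃ (i : C.cell n) (a : G ⧸ C.isotropy n i) (z : UnitDisk n),
      ‖(z : EuclideanSpace ℝ (Fin n))‖ < 1 ∧ C.charMap n i (a, z) = y := by
  obtain ⟨⟨i, a, z⟩, hz, h⟩ := (C.bijOn_charMap n).surjOn ⟨hy, hy'⟩
  exact ⟨i, a, z, hz, h⟩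

theorem skel_succ_cases {n : ℕ} {y : X} (hy : y ∈ C.skel (n + 1)) : y ∈ C.skel n ∨
    ∃ (i : C.cell n) (a : G ⧸ C.isotropy n i) (z : UnitDisk n),
      ‖(z : EuclideanSpace ℝ (Fin n))‖ < 1 ∧ C.charMap n i (a, z) = y := by
  by_cases h : y ∈ C.skel n
  · exact .inl h
  · exact .inr (C.exists_charMap_eq hy h)

/-- The set-theoretic pushout property of a skeleton. -/
theorem exists_extension {Z : Type*} (n : ℕ) (f : X → Z)
    (F : ∀ i : C.cell n, (G ⧸ C.isotropy n i) × UnitDisk n → Z)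
    (hF : ∀ i a (w : UnitDisk n), ‖(w : EuclideanSpace ℝ (Fin n))‖ = 1 →
      F i (a, w) = f (C.charMap n i (a, w))) :
    ∃ f' : X → Z, (∀ y ∈ C.skel n, f' y = f y) ∧ ∀ i p, f' (C.charMap n i p) = F i p := by
  classical
  have key : ∀ y : X, ∃ z : Z, (y ∈ C.skel n → z = f y) ∧
      ∀ i p, C.charMap n i p = y → z = F i p := by
    intro y
    by_cases hy : y ∈ C.skel n
    · refine ⟨f y, fun _ => rfl, ?_⟩
      rintro i ⟨a, w⟩ rfl
      rcases w.norm_le_one.lt_or_eq with h | h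
      · exact absurd hy (C.charMap_notMem_skel h)
      · exact (hF i a w h).symm
    · by_cases hy' : y ∈ C.skel (n + 1)
      · obtain ⟨i, a, z, hz, rfl⟩ := C.exists_charMap_eq hy' hy
        refine ⟨F i (a, z), fun h => absurd h hy, ?_⟩
        rintro j ⟨b, w⟩ h
        rcases w.norm_le_one.lt_or_eq with hw | hw
        · obtain ⟨rfl, h', rfl⟩ := C.charMap_injective hw hz h
          rw [eq_of_heq h']
        · exact absurd (h ▸ C.charMap_mem_skel n j b w hw) hy
      -- Points outside the next skeleton carry an irrelevant default value.
      · refine ⟨f y, fun _ => rfl, ?_⟩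
        rintro i ⟨a, w⟩ rfl
        exact absurd (C.charMap_mem_skel_succ n i a w) hy'
  choose f' h1 h2 using key
  exact ⟨f', h1, fun i p => h2 _ i p rfl⟩

/-- The topological pushout property of a skeleton, for maps defined on a closed subset. -/
theorem continuousOn_inter_skel_succ {Z : Type*} [TopologicalSpace Z] {n : ℕ} {f : X → Z}
    {D : Set X} (hD : IsClosed D) (hf : ContinuousOn f (D ∩ C.skel n))
    (hF : ∀ i, ContinuousOn (fun p => f (C.charMap n i p)) (C.charMap n i ⁻¹' D)) :
    ContinuousOn f (D ∩ C.skel (n + 1)) := by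
  rw [continuousOn_iff_isClosed]
  intro B hB
  refine ⟨(D ∩ C.skel (n + 1)) ∩ f ⁻¹' B, ?_, by ext; simp; tauto⟩
  refine C.isClosed_of_subset_skel n _ (fun y hy => hy.1.2) ?_ fun i => ?_
  · convert hf.preimage_isClosed_of_isClosed (hD.inter (C.isClosed_skel n)) hB using 1
    ext y
    have := @C.skel_subset_succ n y
    simp
    tauto
  · convert (hF i).preimage_isClosed_of_isClosed (hD.preimage (C.continuous_charMap n i)) hB
      using 1
    ext ⟨a, z⟩
    simp [C.charMap_mem_skel_succ]

/-- The topological colimit property, for maps defined on a closed subset. -/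
theorem continuousOn_of_inter_skel {Z : Type*} [TopologicalSpace Z] {f : X → Z}
    {D : Set X} (hD : IsClosed D) (N : ℕ) (hf : ∀ n, N ≤ n → ContinuousOn f (D ∩ C.skel n)) :
    ContinuousOn f D := by
  rw [continuousOn_iff_isClosed]
  intro B hB
  refine ⟨D ∩ f ⁻¹' B, ?_, by ext; simp; tauto⟩
  refine C.isClosed_of_inter_skel _ fun n => ?_
  convert (((hf (max N n) (le_max_left _ _)).preimage_isClosed_of_isClosed
    (hD.inter (C.isClosed_skel _)) hB).inter (C.isClosed_skel n)) using 1
  ext y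
  have := C.skel_mono (le_max_right N n) (a := y)
  simp
  tauto

/-- The image of a closed subset of an open cell is closed. -/
theorem isClosed_image_charMap {n : ℕ} (i : C.cell n) {Q : Set ((G ⧸ C.isotropy n i) × UnitDisk n)}
    (hQ : IsClosed Q) (hQ' : ∀ p ∈ Q, ‖(p.2 : EuclideanSpace ℝ (Fin n))‖ < 1) :
    IsClosed (C.charMap n i '' Q) := by
  have hne : C.charMap n i '' Q ∩ C.skel n = ∅ := by
    refine Set.eq_empty_of_forall_notMem ?_
    rintro _ ⟨⟨⟨a, z⟩, hp, rfl⟩, h⟩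
    exact C.charMap_notMem_skel (hQ' _ hp) h
  refine C.isClosed_of_subset_skel n _ ?_ (by rw [hne]; exact isClosed_empty) fun j => ?_
  · rintro _ ⟨⟨a, z⟩, -, rfl⟩
    exact C.charMap_mem_skel_succ n i a z
  -- By injectivity on open cells, the preimage of the image is `Q` in the cell `i` and empty in all
  -- others.
  · have key : ∀ (b : G ⧸ C.isotropy n j) (w : UnitDisk n),
        C.charMap n j (b, w) ∈ C.charMap n i '' Q → ∃ (a : G ⧸ C.isotropy n i) (z : UnitDisk n),
          (a, z) ∈ Q ∧ i = j ∧ a ≍ b ∧ z = w := by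
      rintro b w ⟨⟨a, z⟩, hp, h⟩
      have hz : ‖(z : EuclideanSpace ℝ (Fin n))‖ < 1 := hQ' (a, z) hp
      refine ⟨a, z, hp, C.charMap_injective hz ?_ h⟩
      refine w.norm_le_one.lt_of_ne fun hw => C.charMap_notMem_skel (i := i) (a := a) hz ?_
      rw [h]
      exact C.charMap_mem_skel n j b w hw
    by_cases hij : i = j
    · subst hij
      convert hQ using 1
      ext ⟨b, w⟩
      refine ⟨fun h => ?_, fun h => ⟨_, h, rfl⟩⟩
      obtain ⟨a, z, hp, -, hab, rfl⟩ := key b w h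
      rwa [← eq_of_heq hab]
    · convert isClosed_empty using 1
      refine Set.eq_empty_of_forall_notMem ?_
      rintro ⟨b, w⟩ h
      obtain ⟨a, z, hp, hij', -⟩ := key b w h
      exact hij hij'

/-! ### Invariance of skeleta, and orbits -/

theorem smul_mem_skel {n : ℕ} (g : G) {y : X} (hy : y ∈ C.skel n) : g • y ∈ C.skel n := by
  induction n with
  | zero => simp [C.skel_zero] at hy
  | succ n ih =>
    rcases C.skel_succ_cases hy with h | ⟨i, a, z, -, rfl⟩
    · exact C.skel_subset_succ n (ih h)
    · rw [← C.charMap_smul]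
      exact C.charMap_mem_skel_succ n i _ z

theorem exists_mem_skel (y : X) : ∃ n, y ∈ C.skel n := by
  have : y ∈ ⋃ n, C.skel n := C.iUnion_skel ▸ Set.mem_univ y
  simpa using this

theorem exists_open_cell (y : X) : ∃ (n : ℕ) (i : C.cell n) (a : G ⧸ C.isotropy n i)
    (z : UnitDisk n), ‖(z : EuclideanSpace ℝ (Fin n))‖ < 1 ∧ C.charMap n i (a, z) = y := by
  obtain ⟨n, hn⟩ := C.exists_mem_skel y
  induction n with
  | zero => simp [C.skel_zero] at hn
  | succ n ih => exact (C.skel_succ_cases hn).elim ih fun h => ⟨n, h⟩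

/-- Orbits of an equivariant CW-complex are closed and homogeneous. -/
theorem isClosedEmbedding_orbit (C : GCWComplex.{u, v, w} G X) [SeparatelyContinuousMul G] (x : X) :
    IsClosedEmbedding (MulAction.ofQuotientStabilizer G x) := by
  obtain ⟨n, i, a, z, hz, rfl⟩ := C.exists_open_cell x
  obtain ⟨k, rfl⟩ := QuotientGroup.mk_surjective a
  set x := C.charMap n i ((k : G ⧸ C.isotropy n i), z) with hx
  -- The orbit is the copy of `G ⧸ H` at height `z` in the cell; in these coordinates the orbit map
  -- is right translation by `k`.
  have hsmul : ∀ g : G, g • x = C.charMap n i (((g * k : G) : G ⧸ C.isotropy n i), z) :=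
    fun g => (C.charMap_smul n i g _ z).symm
  refine .of_continuous_injective_isClosedMap ?_ (MulAction.injective_ofQuotientStabilizer G x) ?_
  · rw [(QuotientGroup.isQuotientMap_mk _).continuous_iff]
    refine ((C.continuous_charMap n i).comp (f := fun g : G =>
      (((g * k : G) : G ⧸ C.isotropy n i), z)) ?_).congr fun g => (hsmul g).symm
    exact (QuotientGroup.continuous_mk.comp (continuous_mul_const k)).prodMk continuous_const
  · intro B hB
    have key : ∀ g : G, g • x ∈ MulAction.ofQuotientStabilizer G x '' B ↔
        (g : G ⧸ MulAction.stabilizer G x) ∈ B := fun g =>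
      (MulAction.injective_ofQuotientStabilizer G x).mem_set_image (s := B)
        (a := (g : G ⧸ MulAction.stabilizer G x))
    have hQ : IsClosed {c : G ⧸ C.isotropy n i | C.charMap n i (c, z) ∈
        MulAction.ofQuotientStabilizer G x '' B} := by
      rw [← (QuotientGroup.isQuotientMap_mk _).isClosed_preimage]
      convert hB.preimage (QuotientGroup.continuous_mk.comp (continuous_mul_const k⁻¹)) using 1
      ext g
      have := key (g * k⁻¹)
      rw [hsmul, inv_mul_cancel_right] at this
      exact this
    convert C.isClosed_image_charMap i (hQ.prod (isClosed_singleton (x := z))) ?_ using 1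
    · ext y
      constructor
      · rintro ⟨b, hb, rfl⟩
        obtain ⟨g, rfl⟩ := QuotientGroup.mk_surjective b
        refine ⟨(((g * k : G) : G ⧸ C.isotropy n i), z), ⟨?_, rfl⟩, (hsmul g).symm⟩
        exact ⟨g, hb, hsmul g⟩
      · rintro ⟨⟨c, w⟩, ⟨hc, rfl⟩, rfl⟩
        exact hc
    · rintro ⟨c, w⟩ ⟨-, rfl⟩
      exact hz

/-- For every neighborhood `N` of `k`, the set `N • x` is a neighborhood of `k • x` in the orbit
of `x`. -/
theorem exists_orbit_nhd (C : GCWComplex.{u, v, w} G X) [SeparatelyContinuousMul G] (x : X) {N : Set G} (hN : IsOpen N) {k : G}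
    (hk : k ∈ N) : ∃ O : Set X, IsOpen O ∧ k • x ∈ O ∧
      ∀ g : G, g • x ∈ O → ∃ g' ∈ N, g' • x = g • x := by
  obtain ⟨O, hO, h⟩ := (C.isClosedEmbedding_orbit x).isInducing.isOpen_iff.1
    (QuotientGroup.isOpenMap_coe (N := MulAction.stabilizer G x) N hN)
  have key : ∀ g : G, g • x ∈ O ↔ (g : G ⧸ MulAction.stabilizer G x) ∈
      ((↑) : G → G ⧸ MulAction.stabilizer G x) '' N := fun g => by
    rw [← h]
    rfl
  refine ⟨O, hO, (key k).2 ⟨k, hk, rfl⟩, fun g hg => ?_⟩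
  obtain ⟨g', hg', h'⟩ := (key g).1 hg
  exact ⟨g', hg', congrArg (MulAction.ofQuotientStabilizer G x) h'⟩

end GCWComplex

/-! ### Tubes around an orbit -/

/-- A tube around the orbit of `x` in the `G`-space `K`: a gauge function on `K` together with an
equivariant flow on the part of `K` where the gauge is at most `1`, which decreases the gauge and
ends in the orbit of `x`. The points that flow to `x` lie in `V`. -/
structure IsTube (G : Type u) {X : Type v} [Group G] [TopologicalSpace X] [MulAction G X] (x : X)
    (V K : Set X) (gauge : X → ℝ) (flow : X → C(ℝ, X)) : Prop where
  base_mem : x ∈ K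
  gauge_base : gauge x = 0
  flow_base : flow x 1 = x
  gauge_nonneg : ∀ y ∈ K, 0 ≤ gauge y
  gauge_le_two : ∀ y ∈ K, gauge y ≤ 2
  gauge_smul : ∀ (g : G), ∀ y ∈ K, gauge (g • y) = gauge y
  continuousOn_gauge : ContinuousOn gauge K
  continuousOn_flow : ContinuousOn flow (K ∩ {y | gauge y ≤ 1})
  flow_smul : ∀ (g : G), ∀ y ∈ K, gauge y ≤ 1 → ∀ t, flow (g • y) t = g • flow y t
  flow_of_nonpos : ∀ y ∈ K, gauge y ≤ 1 → ∀ t ≤ 0, flow y t = y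
  flow_one : ∀ y ∈ K, gauge y ≤ 1 → ∃ g : G, flow y 1 = g • x
  flow_mem : ∀ y ∈ K, gauge y ≤ 1 → ∀ t, 0 ≤ t → t ≤ 1 → flow y t ∈ K
  gauge_flow_le : ∀ y ∈ K, gauge y ≤ 1 → ∀ t, 0 ≤ t → t ≤ 1 → gauge (flow y t) ≤ gauge y
  flow_flow_one : ∀ y ∈ K, gauge y ≤ 1 → ∀ t, 0 ≤ t → t ≤ 1 → flow (flow y t) 1 = flow y 1
  mem_of_flow_one_eq : ∀ y ∈ K, gauge y ≤ 1 → flow y 1 = x → y ∈ V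

/-! ### Extending a tube over the next skeleton -/

namespace GCWComplex

variable {G : Type u} {X : Type v} [Group G] [TopologicalSpace G] [TopologicalSpace X]
  [MulAction G X] {C : GCWComplex.{u, v, w} G X} {x : X} {V : Set X}

/-- Over a cell attached to a tube, the points of the cell lying radially close to the fiber over
`x` are in `V`. The required distance does not depend on the position along the cell. -/
theorem exists_collar [T2Space G] [CompactlyGeneratedSpace G] [IsKGroup G] (hV : IsOpen V)
    (hVinv : ∀ h ∈ MulAction.stabilizer G x, ∀ y ∈ V, h • y ∈ V) {m : ℕ} {gauge : X → ℝ}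
    {flow : X → C(ℝ, X)} (T : IsTube G x V (C.skel m) gauge flow) (j : C.cell m) :
    ∃ δ : ℝ, 0 < δ ∧ δ ≤ 1 / 4 ∧ ∀ (a : G ⧸ C.isotropy m j) (u : UnitDisk m) (s : ℝ),
      ‖(u : EuclideanSpace ℝ (Fin m))‖ = 1 → gauge (C.charMap m j (a, u)) ≤ 1 →
      flow (C.charMap m j (a, u)) 1 = x → 1 - δ ≤ s → s ≤ 1 →
      C.charMap m j (a, UnitDisk.radial s u) ∈ V := by
  have := IsKGroup.separatelyContinuousMul G
  let e : G ⧸ C.isotropy m j := ((1 : G) : G ⧸ C.isotropy m j)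
  have hg : ∀ (g : G) (u : UnitDisk m),
      C.charMap m j ((g : G ⧸ C.isotropy m j), u) = g • C.charMap m j (e, u) := fun g u => by
    rw [← C.charMap_smul, MulAction.Quotient.smul_coe, smul_eq_mul, mul_one]
  have hskel : ∀ (a : G ⧸ C.isotropy m j) (u : UnitDisk m),
      ‖(u : EuclideanSpace ℝ (Fin m))‖ = 1 → C.charMap m j (a, u) ∈ C.skel m :=
    fun a u hu => C.charMap_mem_skel m j a u hu
  -- Invariance of the gauge makes the base coset sufficient here; what remains is a compact part of
  -- the sphere.
  let A : Set (UnitDisk m) := {u | ‖(u : EuclideanSpace ℝ (Fin m))‖ = 1} ∩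
    (fun u => gauge (C.charMap m j (e, u))) ⁻¹' Set.Iic 1
  have hcont : Continuous fun u : UnitDisk m => C.charMap m j (e, u) :=
    (C.continuous_charMap m j).comp (by fun_prop)
  have hAclosed : IsClosed A := by
    refine ContinuousOn.preimage_isClosed_of_isClosed ?_ ?_ isClosed_Iic
    · exact T.continuousOn_gauge.comp hcont.continuousOn fun u hu => hskel e u hu
    · exact isClosed_eq (by fun_prop) continuous_const
  have : CompactSpace (UnitDisk m) := isCompact_iff_compactSpace.1 (isCompact_closedBall _ _)
  have key : ∃ δ : ℝ, 0 < δ ∧ δ ≤ 1 / 4 ∧ ∀ u ∈ A, ∀ (a : G ⧸ C.isotropy m j) (s : ℝ),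
      flow (C.charMap m j (a, u)) 1 = x → 1 - δ ≤ s → s ≤ 1 →
      C.charMap m j (a, UnitDisk.radial s u) ∈ V := by
    refine hAclosed.isCompact.induction_on (p := fun B => ∃ δ : ℝ, 0 < δ ∧ δ ≤ 1 / 4 ∧ ∀ u ∈ B,
      ∀ (a : G ⧸ C.isotropy m j) (s : ℝ), flow (C.charMap m j (a, u)) 1 = x → 1 - δ ≤ s → s ≤ 1 →
      C.charMap m j (a, UnitDisk.radial s u) ∈ V) ?_ ?_ ?_ ?_
    · exact ⟨1 / 4, by norm_num, le_rfl, by simp⟩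
    · rintro B B' hBB' ⟨δ, h0, h1, h⟩
      exact ⟨δ, h0, h1, fun u hu => h u (hBB' hu)⟩
    · rintro B B' ⟨δ, h0, h1, h⟩ ⟨δ', h0', h1', h'⟩
      refine ⟨min δ δ', lt_min h0 h0', (min_le_left _ _).trans h1, ?_⟩
      rintro u (hu | hu) a s hx hs hs'
      · exact h u hu a s hx (by linarith [min_le_left δ δ']) hs'
      · exact h' u hu a s hx (by linarith [min_le_right δ δ']) hs'
    · rintro u₀ ⟨hu₀, hu₀'⟩
      -- The base point over `u₀` flows to `k • x`, so its translate by `k⁻¹` flows to `x` and lies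
      -- in `V`.
      obtain ⟨k, hk⟩ := T.flow_one _ (hskel e u₀ hu₀) hu₀'
      have hmem : C.charMap m j (((k⁻¹ : G) : G ⧸ C.isotropy m j), u₀) ∈ V := by
        refine T.mem_of_flow_one_eq _ (hskel _ u₀ hu₀) ?_ ?_
        · rw [hg, T.gauge_smul _ _ (hskel e u₀ hu₀)]
          exact hu₀'
        · rw [hg, T.flow_smul _ _ (hskel e u₀ hu₀) hu₀', hk, inv_smul_smul]
      have hψ : Continuous fun p : G × UnitDisk m × ℝ =>
          C.charMap m j ((p.1 : G ⧸ C.isotropy m j), UnitDisk.radial p.2.2 p.2.1) :=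
        (C.continuous_charMap m j).comp
          ((QuotientGroup.continuous_mk.comp continuous_fst).prodMk (by fun_prop))
      have hnhd : (fun p : G × UnitDisk m × ℝ =>
          C.charMap m j ((p.1 : G ⧸ C.isotropy m j), UnitDisk.radial p.2.2 p.2.1)) ⁻¹' V ∈
          𝓝 ((k⁻¹, u₀, 1) : G × UnitDisk m × ℝ) := by
        refine (hV.preimage hψ).mem_nhds ?_
        simpa [UnitDisk.radial_one] using hmem
      obtain ⟨N₀, hN₀, M, hM, hNM⟩ := mem_nhds_prod_iff.1 hnhd
      obtain ⟨N₁, hN₁, N₂, hN₂, hNN⟩ := mem_nhds_prod_iff.1 hM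
      obtain ⟨N, hNN₀, hNo, hkN⟩ := mem_nhds_iff.1 hN₀
      obtain ⟨η, hη, hηN⟩ := Metric.mem_nhds_iff.1 hN₂
      -- Orbit points in `O` have the form `n • x` with `n⁻¹ ∈ N`, where `N` is a neighborhood of
      -- `k⁻¹`.
      obtain ⟨O, hO, hkO, hON⟩ := C.exists_orbit_nhd x
        (hNo.preimage (IsKGroup.continuous_inv (G := G))) (k := k) hkN
      have hr : ContinuousOn (fun u : UnitDisk m => flow (C.charMap m j (e, u)) 1) A := by
        refine (continuous_eval_const (1 : ℝ)).comp_continuousOn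
          (T.continuousOn_flow.comp hcont.continuousOn ?_)
        exact fun u hu => ⟨hskel e u hu.1, hu.2⟩
      have hO' : A ∩ (fun u : UnitDisk m => flow (C.charMap m j (e, u)) 1) ⁻¹' O ∈ 𝓝[A] u₀ :=
        Filter.inter_mem self_mem_nhdsWithin
          ((hr u₀ ⟨hu₀, hu₀'⟩).preimage_mem_nhdsWithin (hO.mem_nhds (by rw [hk]; exact hkO)))
      refine ⟨_, Filter.inter_mem (mem_nhdsWithin_of_mem_nhds hN₁) hO', min (η / 2) (1 / 4),
        lt_min (by linarith) (by norm_num), min_le_right _ _, ?_⟩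
      rintro u ⟨huN, hu, huO⟩ a s hx hs hs'
      obtain ⟨g, rfl⟩ := QuotientGroup.mk_surjective a
      obtain ⟨c, hc⟩ := T.flow_one _ (hskel e u hu.1) hu.2
      obtain ⟨n, hn, hnc⟩ := hON c (by rw [← hc]; exact huO)
      have hs2 : s ∈ N₂ := hηN <| by
        rw [Metric.mem_ball, Real.dist_eq, abs_sub_lt_iff]
        constructor <;> linarith [min_le_left (η / 2) (1 / 4)]
      have hV' : C.charMap m j (((n⁻¹ : G) : G ⧸ C.isotropy m j), UnitDisk.radial s u) ∈ V :=
        hNM (Set.mk_mem_prod (hNN₀ hn) (hNN (Set.mk_mem_prod huN hs2)))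
      -- The base point over `u` flows to `n • x` and its `g`-translate to `x`. Hence `g = (g * n) *
      -- n⁻¹` with `g * n` in the stabilizer: the `n⁻¹`-translate lies in `V` by nearness, and
      -- invariance of `V` carries it to the `g`-translate.
      have hstab : g * n ∈ MulAction.stabilizer G x := by
        rw [MulAction.mem_stabilizer_iff, mul_smul, hnc, ← hc,
          ← T.flow_smul _ _ (hskel e u hu.1) hu.2, ← hg]
        exact hx
      have := hVinv _ hstab _ hV'
      rwa [hg, ← mul_smul, mul_inv_cancel_right, ← hg] at this
  obtain ⟨δ, h0, h1, h⟩ := key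
  refine ⟨δ, h0, h1, fun a u s hu ha hx hs hs' => h u ⟨hu, ?_⟩ a s hx hs hs'⟩
  obtain ⟨g, rfl⟩ := QuotientGroup.mk_surjective a
  rw [hg, T.gauge_smul _ _ (hskel e u hu)] at ha
  exact ha

/-- Follow the radius of a cell at unit speed to its boundary and then the path `f`,
reparametrized to end at time `1`. -/
noncomputable def collarPath {m : ℕ} (j : C.cell m) (f : X → C(ℝ, X))
    (p : (G ⧸ C.isotropy m j) × UnitDisk m) (t : ℝ) : X :=
  if t ≤ 1 - ‖(p.2 : EuclideanSpace ℝ (Fin m))‖ then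
    C.charMap m j (p.1, UnitDisk.radial (‖(p.2 : EuclideanSpace ℝ (Fin m))‖ + max 0 t) p.2.bd)
  else f (C.charMap m j (p.1, p.2.bd))
    ((t - (1 - ‖(p.2 : EuclideanSpace ℝ (Fin m))‖)) / ‖(p.2 : EuclideanSpace ℝ (Fin m))‖)

/-- The part of a cell that lies radially above the part of the boundary with gauge at
most `1`. -/
def collarDomain {m : ℕ} (j : C.cell m) (gauge : X → ℝ) :
    Set ((G ⧸ C.isotropy m j) × UnitDisk m) :=
  {p | 1 / 2 ≤ ‖(p.2 : EuclideanSpace ℝ (Fin m))‖ ∧ gauge (C.charMap m j (p.1, p.2.bd)) ≤ 1}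

/-- At the switching time `1 - ‖w‖` the radial branch has reached the boundary point and the old
flow is still at time 0, so the branches agree. The bound `1 / 2 ≤ ‖w‖` keeps `bd` radial and the
rescaling of time continuous. -/
theorem continuous_collarPath {m : ℕ} {gauge : X → ℝ} {flow : X → C(ℝ, X)}
    (T : IsTube G x V (C.skel m) gauge flow) (j : C.cell m) :
    Continuous fun q : collarDomain j gauge × ℝ => collarPath j flow q.1.1 q.2 := by
  have hcell : Continuous fun p : collarDomain j gauge =>
      C.charMap m j (p.1.1, p.1.2.bd) := (C.continuous_charMap m j).comp (by fun_prop)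
  have hflow : Continuous fun p : collarDomain j gauge =>
      flow (C.charMap m j (p.1.1, p.1.2.bd)) :=
    T.continuousOn_flow.comp_continuous hcell
      fun p => ⟨C.charMap_mem_skel m j _ _ (UnitDisk.norm_bd p.2.1), p.2.2⟩
  have hne : ∀ q : collarDomain j gauge × ℝ, ‖(q.1.1.2 : EuclideanSpace ℝ (Fin m))‖ ≠ 0 :=
    fun q => by linarith [q.1.2.1]
  unfold collarPath
  refine Continuous.if_le ?_ ?_ (by fun_prop) (by fun_prop) ?_
  · exact (C.continuous_charMap m j).comp (by fun_prop)
  · refine ContinuousEval.continuous_eval.comp ((hflow.comp continuous_fst).prodMk ?_)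
    exact Continuous.div (by fun_prop) (by fun_prop) hne
  · intro q hq
    have h1 := q.1.1.2.norm_le_one
    rw [hq, max_eq_right (by linarith), sub_self, zero_div, add_sub_cancel, UnitDisk.radial_one,
      T.flow_of_nonpos _ (C.charMap_mem_skel m j _ _ (UnitDisk.norm_bd q.1.2.1)) q.1.2.2 0 le_rfl]

set_option maxHeartbeats 400000 in
/-- A tube over a skeleton extends to the next skeleton. -/
theorem exists_tube_succ [T2Space G] [CompactlyGeneratedSpace G] [IsKGroup G] (hV : IsOpen V)
    (hVinv : ∀ h ∈ MulAction.stabilizer G x, ∀ y ∈ V, h • y ∈ V) {m : ℕ} {gauge : X → ℝ}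
    {flow : X → C(ℝ, X)} (T : IsTube G x V (C.skel m) gauge flow) :
    ∃ (gauge' : X → ℝ) (flow' : X → C(ℝ, X)), IsTube G x V (C.skel (m + 1)) gauge' flow' ∧
      (∀ y ∈ C.skel m, gauge' y = gauge y) ∧ ∀ y ∈ C.skel m, flow' y = flow y := by
  classical
  choose δ hδ0 hδ1 hδV using exists_collar hV hVinv T
  have hskel : ∀ (j : C.cell m) (a : G ⧸ C.isotropy m j) {w : UnitDisk m},
      1 / 2 ≤ ‖(w : EuclideanSpace ℝ (Fin m))‖ → C.charMap m j (a, w.bd) ∈ C.skel m :=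
    fun j a w hw => C.charMap_mem_skel m j a _ (UnitDisk.norm_bd hw)
  -- The new gauge is at most 1 exactly when the depth below the boundary is at most `δ j` and the
  -- boundary point has gauge at most 1.
  let Fg : ∀ j : C.cell m, (G ⧸ C.isotropy m j) × UnitDisk m → ℝ := fun j p =>
    if 1 / 2 ≤ ‖(p.2 : EuclideanSpace ℝ (Fin m))‖ then
      min 2 (max ((1 - ‖(p.2 : EuclideanSpace ℝ (Fin m))‖) / δ j)
        (gauge (C.charMap m j (p.1, p.2.bd))))
    else 2
  let Ff : ∀ j : C.cell m, (G ⧸ C.isotropy m j) × UnitDisk m → C(ℝ, X) := fun j p =>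
    if ‖(p.2 : EuclideanSpace ℝ (Fin m))‖ = 1 then flow (C.charMap m j p)
    else if h : Continuous (collarPath j flow p) then ⟨_, h⟩ else .const ℝ (C.charMap m j p)
  obtain ⟨gauge', hgs, hgc⟩ := C.exists_extension m gauge Fg <| by
    intro j a w hw
    have hm := C.charMap_mem_skel m j a w hw
    have h1 := T.gauge_nonneg _ hm
    have h2 := T.gauge_le_two _ hm
    simp only [Fg, hw, UnitDisk.bd_eq_self hw]
    rw [if_pos (by norm_num), sub_self, zero_div, max_eq_right h1, min_eq_right h2]
  obtain ⟨flow', hfs, hfc⟩ := C.exists_extension m flow Ff fun j a w hw => if_pos hw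
  have hgood : ∀ (j : C.cell m) (a : G ⧸ C.isotropy m j) (w : UnitDisk m),
      gauge' (C.charMap m j (a, w)) ≤ 1 ↔ (1 / 2 ≤ ‖(w : EuclideanSpace ℝ (Fin m))‖ ∧
        gauge (C.charMap m j (a, w.bd)) ≤ 1) ∧ 1 - ‖(w : EuclideanSpace ℝ (Fin m))‖ ≤ δ j := by
    intro j a w
    rw [hgc]
    simp only [Fg]
    split_ifs with h
    · rw [min_le_iff, max_le_iff, div_le_one (hδ0 j)]
      constructor
      · rintro (h' | h')
        · norm_num at h'
        · exact ⟨⟨h, h'.2⟩, h'.1⟩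
      · rintro ⟨⟨-, h1⟩, h2⟩
        exact .inr ⟨h2, h1⟩
    · constructor
      · intro h'
        norm_num at h'
      · rintro ⟨⟨h', -⟩, -⟩
        exact absurd h' h
  have hpath : ∀ (j : C.cell m) (p : (G ⧸ C.isotropy m j) × UnitDisk m),
      p ∈ collarDomain j gauge → ∀ t, flow' (C.charMap m j p) t = collarPath j flow p t := by
    rintro j p hp t
    have hc : Continuous (collarPath j flow p) :=
      (continuous_collarPath T j).comp (f := fun t : ℝ => ((⟨p, hp⟩ : collarDomain j gauge), t))
        (by fun_prop)
    rw [hfc]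
    simp only [Ff]
    rw [dif_pos hc]
    split_ifs with hw
    · have hm := C.charMap_mem_skel m j p.1 p.2 hw
      have hp2 := hp.2
      rw [UnitDisk.bd_eq_self hw] at hp2
      unfold collarPath
      rw [hw, UnitDisk.bd_eq_self hw, sub_self, sub_zero, div_one]
      split_ifs with ht
      · rw [max_eq_left ht, add_zero, UnitDisk.radial_one, T.flow_of_nonpos _ hm hp2 t ht]
      · rfl
    · rfl
  have hpath1 : ∀ (j : C.cell m) (a : G ⧸ C.isotropy m j) (w : UnitDisk m),
      (a, w) ∈ collarDomain j gauge →
        flow' (C.charMap m j (a, w)) 1 = flow (C.charMap m j (a, w.bd)) 1 := by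
    intro j a w hp
    have h1 : 1 / 2 ≤ ‖(w : EuclideanSpace ℝ (Fin m))‖ := hp.1
    rw [hpath j (a, w) hp]
    simp only [collarPath]
    rw [if_neg (by linarith), sub_sub_cancel, div_self (by linarith)]
  have hgw : ∀ (j : C.cell m) (a : G ⧸ C.isotropy m j) (w : UnitDisk m),
      1 / 2 ≤ ‖(w : EuclideanSpace ℝ (Fin m))‖ → gauge' (C.charMap m j (a, w)) =
      min 2 (max ((1 - ‖(w : EuclideanSpace ℝ (Fin m))‖) / δ j)
        (gauge (C.charMap m j (a, w.bd)))) := by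
    intro j a w hw
    rw [hgc]
    exact if_pos hw
  -- During the unit time interval a point is either still on its radius, no deeper than before, or
  -- already on the old flow line of its boundary point. Gauge decrease and compatibility of end
  -- points reduce to these cases.
  have hflow_cases : ∀ (j : C.cell m) (a : G ⧸ C.isotropy m j) (w : UnitDisk m),
      gauge' (C.charMap m j (a, w)) ≤ 1 → ∀ t, 0 ≤ t → t ≤ 1 →
      (∃ w' : UnitDisk m, w'.bd = w.bd ∧
        ‖(w : EuclideanSpace ℝ (Fin m))‖ ≤ ‖(w' : EuclideanSpace ℝ (Fin m))‖ ∧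
        flow' (C.charMap m j (a, w)) t = C.charMap m j (a, w')) ∨
      ∃ t', 0 ≤ t' ∧ t' ≤ 1 ∧
        flow' (C.charMap m j (a, w)) t = flow (C.charMap m j (a, w.bd)) t' := by
    intro j a w hw t ht0 ht1
    obtain ⟨hp, hwδ⟩ := (hgood j a w).1 hw
    rw [hpath j (a, w) hp]
    simp only [collarPath]
    split_ifs with ht
    · left
      have hs : 1 / 2 ≤ ‖(w : EuclideanSpace ℝ (Fin m))‖ + t := by linarith [hp.1]
      rw [max_eq_right ht0]
      refine ⟨_, UnitDisk.bd_radial (UnitDisk.norm_bd hp.1) hs (by linarith), ?_, rfl⟩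
      rw [UnitDisk.norm_radial (UnitDisk.norm_bd hp.1) (by linarith) (by linarith)]
      linarith
    · right
      have h0 : 0 < ‖(w : EuclideanSpace ℝ (Fin m))‖ := by linarith [hp.1]
      refine ⟨_, div_nonneg (by linarith) h0.le, ?_, rfl⟩
      rw [div_le_one h0]
      linarith
  have hcg : ContinuousOn gauge' (C.skel (m + 1)) := by
    have := C.continuousOn_inter_skel_succ (n := m) (f := gauge') isClosed_univ
    simp only [Set.univ_inter] at this
    refine this (T.continuousOn_gauge.congr hgs) fun j => ?_
    have hcl1 : IsClosed {p : (G ⧸ C.isotropy m j) × UnitDisk m |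
        1 / 2 ≤ ‖(p.2 : EuclideanSpace ℝ (Fin m))‖} := isClosed_le continuous_const (by fun_prop)
    have hcl2 : IsClosed {p : (G ⧸ C.isotropy m j) × UnitDisk m |
        ‖(p.2 : EuclideanSpace ℝ (Fin m))‖ ≤ 1 / 2} := isClosed_le (by fun_prop) continuous_const
    have hc1 : ContinuousOn (fun p => gauge' (C.charMap m j p))
        {p | 1 / 2 ≤ ‖(p.2 : EuclideanSpace ℝ (Fin m))‖} := by
      have hb : ContinuousOn (fun p : (G ⧸ C.isotropy m j) × UnitDisk m =>
          gauge (C.charMap m j (p.1, p.2.bd)))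
          {p | 1 / 2 ≤ ‖(p.2 : EuclideanSpace ℝ (Fin m))‖} := by
        refine T.continuousOn_gauge.comp (Continuous.continuousOn ?_) fun p hp => hskel j p.1 hp
        exact (C.continuous_charMap m j).comp (by fun_prop)
      refine ContinuousOn.congr (ContinuousOn.inf continuousOn_const (ContinuousOn.sup (Continuous.continuousOn
        ?_) hb)) fun p hp => hgw j p.1 p.2 hp
      fun_prop
    have hc2 : ContinuousOn (fun p => gauge' (C.charMap m j p))
        {p | ‖(p.2 : EuclideanSpace ℝ (Fin m))‖ ≤ 1 / 2} := by
      refine (continuousOn_const (c := (2 : ℝ))).congr fun p hp => ?_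
      rcases (show ‖(p.2 : EuclideanSpace ℝ (Fin m))‖ ≤ 1 / 2 from hp).lt_or_eq with h | h
      · rw [hgc]
        exact if_neg (not_le.2 h)
      -- At radius `1 / 2` the depth term is `(1 / 2) / δ j ≥ 2` because `δ j ≤ 1 / 4`, so it
      -- matches the value 2 inside.
      · rw [hgw j p.1 p.2 h.ge, min_eq_left]
        refine le_max_of_le_left ?_
        rw [le_div_iff₀ (hδ0 j), h]
        linarith [hδ1 j]
    have := hc1.union_of_isClosed hc2 hcl1 hcl2
    refine this.mono fun p _ => ?_
    exact le_total (1 / 2) ‖(p.2 : EuclideanSpace ℝ (Fin m))‖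
  refine ⟨gauge', flow', ?_, hgs, hfs⟩
  refine
    { base_mem := C.skel_subset_succ m T.base_mem
      gauge_base := by rw [hgs _ T.base_mem, T.gauge_base]
      flow_base := by rw [hfs _ T.base_mem, T.flow_base]
      gauge_nonneg := ?_, gauge_le_two := ?_, gauge_smul := ?_, continuousOn_gauge := hcg
      continuousOn_flow := ?_, flow_smul := ?_, flow_of_nonpos := ?_, flow_one := ?_
      flow_mem := ?_, gauge_flow_le := ?_, flow_flow_one := ?_, mem_of_flow_one_eq := ?_ }
  · intro y hy
    rcases C.skel_succ_cases hy with h | ⟨j, a, w, hw, rfl⟩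
    · rw [hgs y h]
      exact T.gauge_nonneg y h
    · rw [hgc]
      simp only [Fg]
      split_ifs
      · refine le_min (by norm_num) (le_max_of_le_left (div_nonneg ?_ (hδ0 j).le))
        linarith
      · norm_num
  · intro y hy
    rcases C.skel_succ_cases hy with h | ⟨j, a, w, hw, rfl⟩
    · rw [hgs y h]
      exact T.gauge_le_two y h
    · rw [hgc]
      simp only [Fg]
      split_ifs
      · exact min_le_left _ _
      · exact le_rfl
  · intro g y hy
    rcases C.skel_succ_cases hy with h | ⟨j, a, w, hw, rfl⟩
    · rw [hgs y h, hgs _ (C.smul_mem_skel g h), T.gauge_smul g y h]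
    · rw [← C.charMap_smul, hgc, hgc]
      simp only [Fg]
      split_ifs with h
      · rw [C.charMap_smul, T.gauge_smul g _ (hskel j a h)]
      · rfl
  · have hD : IsClosed (C.skel (m + 1) ∩ {y | gauge' y ≤ 1}) :=
      hcg.preimage_isClosed_of_isClosed (C.isClosed_skel _) isClosed_Iic
    have := C.continuousOn_inter_skel_succ (n := m) (f := flow') hD
    refine (this ?_ fun j => ?_).mono fun y hy => ⟨hy, hy.1⟩
    · refine (T.continuousOn_flow.mono ?_).congr fun y hy => hfs y hy.2
      rintro y ⟨⟨-, h⟩, hy⟩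
      refine ⟨hy, ?_⟩
      have : gauge' y ≤ 1 := h
      rwa [hgs y hy] at this
    · rw [continuousOn_iff_continuous_domRestrict]
      -- Currying turns joint continuity of `collarPath` into continuity into `C(ℝ, X)`.
      refine ContinuousMap.continuous_of_continuous_uncurry _ ?_
      have hmem : ∀ p : C.charMap m j ⁻¹' (C.skel (m + 1) ∩ {y | gauge' y ≤ 1}),
          p.1 ∈ collarDomain j gauge := fun p => ((hgood j p.1.1 p.1.2).1 p.2.2).1
      refine ((continuous_collarPath T j).comp (f := fun q : C.charMap m j ⁻¹'
        (C.skel (m + 1) ∩ {y | gauge' y ≤ 1}) × ℝ =>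
          ((⟨q.1.1, hmem q.1⟩ : collarDomain j gauge), q.2)) ?_).congr fun q => ?_
      · exact ((continuous_subtype_val.comp continuous_fst).subtype_mk _).prodMk continuous_snd
      · exact (hpath j q.1.1 (hmem q.1) q.2).symm
  · intro g y hy hy1 t
    rcases C.skel_succ_cases hy with h | ⟨j, a, w, hw, rfl⟩
    · rw [hfs y h, hfs _ (C.smul_mem_skel g h)]
      rw [hgs y h] at hy1
      exact T.flow_smul g y h hy1 t
    · obtain ⟨hp, hwδ⟩ := (hgood j a w).1 hy1
      have hp' : (g • a, w) ∈ collarDomain j gauge := by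
        refine ⟨hp.1, ?_⟩
        rw [C.charMap_smul, T.gauge_smul g _ (hskel j a hp.1)]
        exact hp.2
      rw [← C.charMap_smul, hpath j (a, w) hp, hpath j (g • a, w) hp']
      simp only [collarPath]
      split_ifs with ht
      · rw [C.charMap_smul]
      · rw [C.charMap_smul, T.flow_smul g _ (hskel j a hp.1) hp.2]
  · intro y hy hy1 t ht
    rcases C.skel_succ_cases hy with h | ⟨j, a, w, hw, rfl⟩
    · rw [hfs y h]
      rw [hgs y h] at hy1
      exact T.flow_of_nonpos y h hy1 t ht
    · obtain ⟨hp, hwδ⟩ := (hgood j a w).1 hy1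
      rw [hpath j (a, w) hp]
      simp only [collarPath]
      rw [if_pos (by linarith), max_eq_left ht, add_zero, UnitDisk.radial_norm_bd hp.1]
  · intro y hy hy1
    rcases C.skel_succ_cases hy with h | ⟨j, a, w, hw, rfl⟩
    · rw [hfs y h]
      rw [hgs y h] at hy1
      exact T.flow_one y h hy1
    · obtain ⟨hp, hwδ⟩ := (hgood j a w).1 hy1
      rw [hpath1 j a w hp]
      exact T.flow_one _ (hskel j a hp.1) hp.2
  · intro y hy hy1 t ht0 ht1
    rcases C.skel_succ_cases hy with h | ⟨j, a, w, hw, rfl⟩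
    · rw [hfs y h]
      rw [hgs y h] at hy1
      exact C.skel_subset_succ m (T.flow_mem y h hy1 t ht0 ht1)
    · obtain ⟨hp, hwδ⟩ := (hgood j a w).1 hy1
      rcases hflow_cases j a w hy1 t ht0 ht1 with ⟨w', -, -, h⟩ | ⟨t', h0, h1, h⟩
      · rw [h]
        exact C.charMap_mem_skel_succ m j a w'
      · rw [h]
        exact C.skel_subset_succ m (T.flow_mem _ (hskel j a hp.1) hp.2 t' h0 h1)
  · intro y hy hy1 t ht0 ht1
    rcases C.skel_succ_cases hy with h | ⟨j, a, w, hw, rfl⟩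
    · rw [hgs y h] at hy1 ⊢
      rw [hfs y h, hgs _ (T.flow_mem y h hy1 t ht0 ht1)]
      exact T.gauge_flow_le y h hy1 t ht0 ht1
    · obtain ⟨hp, hwδ⟩ := (hgood j a w).1 hy1
      have hp1 : 1 / 2 ≤ ‖(w : EuclideanSpace ℝ (Fin m))‖ := hp.1
      rcases hflow_cases j a w hy1 t ht0 ht1 with ⟨w', hb, hn, h⟩ | ⟨t', h0, h1, h⟩
      · rw [h, hgw j a w hp1, hgw j a w' (hp1.trans hn), hb]
        have := (hδ0 j).le
        gcongr
      · have hm := T.flow_mem _ (hskel j a hp1) hp.2 t' h0 h1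
        rw [h, hgs _ hm, hgw j a w hp1]
        refine (T.gauge_flow_le _ (hskel j a hp1) hp.2 t' h0 h1).trans (le_min ?_ (le_max_right _ _))
        exact T.gauge_le_two _ (hskel j a hp1)
  · intro y hy hy1 t ht0 ht1
    rcases C.skel_succ_cases hy with h | ⟨j, a, w, hw, rfl⟩
    · rw [hgs y h] at hy1
      rw [hfs y h, hfs _ (T.flow_mem y h hy1 t ht0 ht1)]
      exact T.flow_flow_one y h hy1 t ht0 ht1
    · obtain ⟨hp, hwδ⟩ := (hgood j a w).1 hy1
      have hp1 : 1 / 2 ≤ ‖(w : EuclideanSpace ℝ (Fin m))‖ := hp.1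
      rw [hpath1 j a w hp]
      rcases hflow_cases j a w hy1 t ht0 ht1 with ⟨w', hb, hn, h⟩ | ⟨t', h0, h1, h⟩
      · have hp' : (a, w') ∈ collarDomain j gauge := by
          refine ⟨hp1.trans hn, ?_⟩
          rw [hb]
          exact hp.2
        rw [h, hpath1 j a w' hp', hb]
      · rw [h, hfs _ (T.flow_mem _ (hskel j a hp1) hp.2 t' h0 h1)]
        exact T.flow_flow_one _ (hskel j a hp1) hp.2 t' h0 h1
  · intro y hy hy1 hyx
    rcases C.skel_succ_cases hy with h | ⟨j, a, w, hw, rfl⟩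
    · rw [hgs y h] at hy1
      rw [hfs y h] at hyx
      exact T.mem_of_flow_one_eq y h hy1 hyx
    · obtain ⟨hp, hwδ⟩ := (hgood j a w).1 hy1
      rw [hpath1 j a w hp] at hyx
      -- The collar width was chosen for this: a point of depth at most `δ j` above a boundary point
      -- flowing to `x` is in `V`.
      have := hδV j a w.bd ‖(w : EuclideanSpace ℝ (Fin m))‖ (UnitDisk.norm_bd hp.1) hp.2 hyx
        (by linarith) w.norm_le_one
      rwa [UnitDisk.radial_norm_bd hp.1] at this

end GCWComplex

/-! ### Straight segments in the disk -/

namespace UnitDisk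

variable {n : ℕ} (z : UnitDisk n)

/-- The segment from `w` to `z`, parametrized by the unit interval. -/
noncomputable def line (w : UnitDisk n) (t : ℝ) : UnitDisk n :=
  retract ((w : EuclideanSpace ℝ (Fin n)) + max 0 (min 1 t) •
    ((z : EuclideanSpace ℝ (Fin n)) - (w : EuclideanSpace ℝ (Fin n))))

theorem continuous_line {Y : Type*} [TopologicalSpace Y] {w : Y → UnitDisk n} {t : Y → ℝ}
    (hw : Continuous w) (ht : Continuous t) : Continuous fun y => line z (w y) (t y) := by
  unfold line
  fun_prop

theorem line_of_nonpos (w : UnitDisk n) {t : ℝ} (ht : t ≤ 0) : line z w t = w := by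
  rw [line, min_eq_right (by linarith), max_eq_left ht, zero_smul, add_zero, retract_coe]

theorem line_one (w : UnitDisk n) : line z w 1 = z := by
  rw [line, min_self, max_eq_right zero_le_one, one_smul, add_sub_cancel, retract_coe]

/-- By convexity the segment stays in the disk, where `retract` does nothing; the difference to `z`
is scaled by `1 - t`. -/
theorem dist_line_le (w : UnitDisk n) {t : ℝ} (h0 : 0 ≤ t) (h1 : t ≤ 1) :
    dist (line z w t) z ≤ dist w z := by
  have hseg : (w : EuclideanSpace ℝ (Fin n)) + t •
      ((z : EuclideanSpace ℝ (Fin n)) - (w : EuclideanSpace ℝ (Fin n))) ∈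
      Metric.closedBall (0 : EuclideanSpace ℝ (Fin n)) 1 :=
    (convex_closedBall _ _).add_smul_sub_mem w.2 z.2 ⟨h0, h1⟩
  rw [line, min_eq_right h1, max_eq_right h0, Subtype.dist_eq, Subtype.dist_eq,
    coe_retract (mem_closedBall_zero_iff.1 hseg), dist_eq_norm, dist_eq_norm]
  have : (w : EuclideanSpace ℝ (Fin n)) + t •
      ((z : EuclideanSpace ℝ (Fin n)) - (w : EuclideanSpace ℝ (Fin n))) -
      (z : EuclideanSpace ℝ (Fin n)) = (1 - t) •
      ((w : EuclideanSpace ℝ (Fin n)) - (z : EuclideanSpace ℝ (Fin n))) := by module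
  rw [this, norm_smul, Real.norm_of_nonneg (by linarith)]
  exact mul_le_of_le_one_left (norm_nonneg _) (by linarith)

end UnitDisk

/-! ### Existence of tubes -/

namespace GCWComplex

variable {G : Type u} {X : Type v} [Group G] [TopologicalSpace G] [TopologicalSpace X]
  [MulAction G X] {C : GCWComplex.{u, v, w} G X} {x : X} {V : Set X}

/-- Every point of an open cell has a tube in the skeleton of that cell. -/
theorem exists_tube_open_cell (hV : IsOpen V) {n : ℕ} (i₀ : C.cell n)
    (a₀ : G ⧸ C.isotropy n i₀) (z : UnitDisk n) (hz : ‖(z : EuclideanSpace ℝ (Fin n))‖ < 1)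
    (hzV : C.charMap n i₀ (a₀, z) ∈ V) :
    ∃ (gauge : X → ℝ) (flow : X → C(ℝ, X)),
      IsTube G (C.charMap n i₀ (a₀, z)) V (C.skel (n + 1)) gauge flow := by
  classical
  obtain ⟨η, hη, hηV⟩ : ∃ η > 0, ∀ w : UnitDisk n, dist w z < η → C.charMap n i₀ (a₀, w) ∈ V := by
    have : (fun w : UnitDisk n => C.charMap n i₀ (a₀, w)) ⁻¹' V ∈ 𝓝 z :=
      (hV.preimage ((C.continuous_charMap n i₀).comp (by fun_prop))).mem_nhds hzV
    obtain ⟨η, hη, h⟩ := Metric.mem_nhds_iff.1 this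
    exact ⟨η, hη, fun w hw => h hw⟩
  -- `ε < η` keeps the slice in `V`. The second bound makes `dist w z / ε` at least 2 on the sphere,
  -- matching the value 2 on the lower skeleton, and keeps the closed `ε`-ball inside the open cell.
  obtain ⟨ε, hε, hεη, hεz⟩ : ∃ ε > 0, ε < η ∧
      2 * ε ≤ 1 - ‖(z : EuclideanSpace ℝ (Fin n))‖ := by
    refine ⟨min (η / 2) ((1 - ‖(z : EuclideanSpace ℝ (Fin n))‖) / 2),
      lt_min (by linarith) (by linarith), ?_, ?_⟩
    · linarith [min_le_left (η / 2) ((1 - ‖(z : EuclideanSpace ℝ (Fin n))‖) / 2)]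
    · linarith [min_le_right (η / 2) ((1 - ‖(z : EuclideanSpace ℝ (Fin n))‖) / 2)]
  have hnorm : ∀ w : UnitDisk n,
      ‖(w : EuclideanSpace ℝ (Fin n))‖ ≤ dist w z + ‖(z : EuclideanSpace ℝ (Fin n))‖ := by
    intro w
    rw [Subtype.dist_eq, dist_eq_norm]
    linarith [norm_le_norm_add_norm_sub' (w : EuclideanSpace ℝ (Fin n))
      (z : EuclideanSpace ℝ (Fin n))]
  let path : ∀ i : C.cell n, (G ⧸ C.isotropy n i) × UnitDisk n → C(ℝ, X) := fun i p =>
    ⟨fun t => C.charMap n i (p.1, UnitDisk.line z p.2 t), (C.continuous_charMap n i).comp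
      (continuous_const.prodMk (UnitDisk.continuous_line z continuous_const continuous_id))⟩
  have hpathc : ∀ i, Continuous (path i) := by
    intro i
    refine ContinuousMap.continuous_of_continuous_uncurry _
      ((C.continuous_charMap n i).comp (f := fun q :
        ((G ⧸ C.isotropy n i) × UnitDisk n) × ℝ => (q.1.1, UnitDisk.line z q.1.2 q.2)) ?_)
    exact (continuous_fst.comp continuous_fst).prodMk (UnitDisk.continuous_line z
      (continuous_snd.comp continuous_fst) continuous_snd)
  let Fg : ∀ i : C.cell n, (G ⧸ C.isotropy n i) × UnitDisk n → ℝ := fun i p =>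
    if i = i₀ then min 2 (dist p.2 z / ε) else 2
  let Ff : ∀ i : C.cell n, (G ⧸ C.isotropy n i) × UnitDisk n → C(ℝ, X) := fun i p =>
    if ‖(p.2 : EuclideanSpace ℝ (Fin n))‖ = 1 then .const ℝ (C.charMap n i p) else path i p
  obtain ⟨gauge, hgs, hgc⟩ := C.exists_extension n (fun _ => (2 : ℝ)) Fg <| by
    intro i a w hw
    simp only [Fg]
    split_ifs
    · rw [min_eq_left]
      rw [le_div_iff₀ hε]
      linarith [hnorm w]
    · rfl
  obtain ⟨flow, hfs, hfc⟩ := C.exists_extension n (fun y => .const ℝ y) Ff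
    fun i a w hw => if_pos hw
  have hgood : ∀ (i : C.cell n) (a : G ⧸ C.isotropy n i) (w : UnitDisk n),
      gauge (C.charMap n i (a, w)) ≤ 1 ↔ i = i₀ ∧ dist w z ≤ ε := by
    intro i a w
    rw [hgc]
    simp only [Fg]
    split_ifs with h
    · rw [min_le_iff, div_le_one hε]
      norm_num [h]
    · norm_num [h]
  have hpath : ∀ (i : C.cell n) (a : G ⧸ C.isotropy n i) (w : UnitDisk n), dist w z ≤ ε →
      flow (C.charMap n i (a, w)) = path i (a, w) := by
    intro i a w hw
    rw [hfc]
    refine if_neg fun h => ?_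
    have h' : ‖(w : EuclideanSpace ℝ (Fin n))‖ = 1 := h
    linarith [hnorm w]
  have hcases : ∀ y ∈ C.skel (n + 1), gauge y ≤ 1 → ∃ (a : G ⧸ C.isotropy n i₀) (w : UnitDisk n),
      dist w z ≤ ε ∧ C.charMap n i₀ (a, w) = y := by
    intro y hy hy1
    rcases C.skel_succ_cases hy with h | ⟨i, a, w, hw, rfl⟩
    · rw [hgs y h] at hy1
      norm_num at hy1
    · obtain ⟨rfl, h⟩ := (hgood i a w).1 hy1
      exact ⟨a, w, h, rfl⟩
  have hcg : ContinuousOn gauge (C.skel (n + 1)) := by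
    have := C.continuousOn_inter_skel_succ (n := n) (f := gauge) isClosed_univ
    simp only [Set.univ_inter] at this
    refine this (continuousOn_const.congr hgs) fun i => Continuous.continuousOn ?_
    refine Continuous.congr (f := Fg i) ?_ fun p => (hgc i p).symm
    dsimp only [Fg]
    split_ifs <;> fun_prop
  refine ⟨gauge, flow, ?_⟩
  refine
    { base_mem := C.charMap_mem_skel_succ n i₀ a₀ z
      gauge_base := ?_, flow_base := ?_
      gauge_nonneg := ?_, gauge_le_two := ?_, gauge_smul := ?_, continuousOn_gauge := hcg
      continuousOn_flow := ?_, flow_smul := ?_, flow_of_nonpos := ?_, flow_one := ?_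
      flow_mem := ?_, gauge_flow_le := ?_, flow_flow_one := ?_, mem_of_flow_one_eq := ?_ }
  · rw [hgc]
    simp [Fg]
  · rw [hpath i₀ a₀ z (by simpa using hε.le)]
    simp [path, UnitDisk.line_one]
  · intro y hy
    rcases C.skel_succ_cases hy with h | ⟨i, a, w, hw, rfl⟩
    · rw [hgs y h]
      norm_num
    · rw [hgc]
      simp only [Fg]
      split_ifs <;> positivity
  · intro y hy
    rcases C.skel_succ_cases hy with h | ⟨i, a, w, hw, rfl⟩
    · rw [hgs y h]
    · rw [hgc]
      simp only [Fg]
      split_ifs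
      · exact min_le_left _ _
      · exact le_rfl
  · intro g y hy
    rcases C.skel_succ_cases hy with h | ⟨i, a, w, hw, rfl⟩
    · rw [hgs y h, hgs _ (C.smul_mem_skel g h)]
    · rw [← C.charMap_smul, hgc, hgc]
  · have hD : IsClosed (C.skel (n + 1) ∩ {y | gauge y ≤ 1}) :=
      hcg.preimage_isClosed_of_isClosed (C.isClosed_skel _) isClosed_Iic
    have := C.continuousOn_inter_skel_succ (n := n) (f := flow) hD
    refine (this ?_ fun i => ?_).mono fun y hy => ⟨hy, hy.1⟩
    · rintro y ⟨⟨-, h1⟩, hy⟩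
      have h1' : gauge y ≤ 1 := h1
      rw [hgs y hy] at h1'
      norm_num at h1'
    · refine (hpathc i).continuousOn.congr ?_
      rintro ⟨a, w⟩ ⟨-, hp⟩
      exact hpath i a w ((hgood i a w).1 hp).2
  · intro g y hy hy1 t
    obtain ⟨a, w, hw, rfl⟩ := hcases y hy hy1
    rw [← C.charMap_smul, hpath _ _ _ hw, hpath _ _ _ hw]
    exact C.charMap_smul n i₀ g a _
  · intro y hy hy1 t ht
    obtain ⟨a, w, hw, rfl⟩ := hcases y hy hy1
    rw [hpath _ _ _ hw]
    simp only [path, ContinuousMap.coe_mk]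
    rw [UnitDisk.line_of_nonpos z w ht]
  · intro y hy hy1
    obtain ⟨a, w, hw, rfl⟩ := hcases y hy hy1
    obtain ⟨g, hg⟩ := MulAction.exists_smul_eq G a₀ a
    refine ⟨g, ?_⟩
    rw [hpath _ _ _ hw, ← C.charMap_smul, hg]
    simp only [path, ContinuousMap.coe_mk]
    rw [UnitDisk.line_one]
  · intro y hy hy1 t ht0 ht1
    obtain ⟨a, w, hw, rfl⟩ := hcases y hy hy1
    rw [hpath _ _ _ hw]
    exact C.charMap_mem_skel_succ n i₀ a _
  · intro y hy hy1 t ht0 ht1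
    obtain ⟨a, w, hw, rfl⟩ := hcases y hy hy1
    rw [hpath _ _ _ hw]
    simp only [path, ContinuousMap.coe_mk]
    rw [hgc, hgc]
    simp only [Fg, if_true]
    have := UnitDisk.dist_line_le z w ht0 ht1
    gcongr
  · intro y hy hy1 t ht0 ht1
    obtain ⟨a, w, hw, rfl⟩ := hcases y hy hy1
    rw [hpath _ _ _ hw]
    simp only [path, ContinuousMap.coe_mk]
    rw [hpath _ _ _ ((UnitDisk.dist_line_le z w ht0 ht1).trans hw)]
    simp only [path, ContinuousMap.coe_mk]
    rw [UnitDisk.line_one, UnitDisk.line_one]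
  · intro y hy hy1 hyx
    obtain ⟨a, w, hw, rfl⟩ := hcases y hy hy1
    rw [hpath _ _ _ hw] at hyx
    simp only [path, ContinuousMap.coe_mk] at hyx
    rw [UnitDisk.line_one] at hyx
    -- The flow does not change the coset coordinate, so only points over `a₀` end at `x`.
    obtain ⟨rfl, -⟩ := C.charMap_injective' hz hz hyx
    exact hηV w (hw.trans_lt hεη)

/-- Every point of an equivariant CW-complex has a tube. -/
theorem exists_tube [T2Space G] [CompactlyGeneratedSpace G] [IsKGroup G]
    (C : GCWComplex.{u, v, w} G X) (x : X) {V : Set X} (hV : IsOpen V) (hxV : x ∈ V)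
    (hVinv : ∀ h ∈ MulAction.stabilizer G x, ∀ y ∈ V, h • y ∈ V) :
    ∃ (gauge : X → ℝ) (flow : X → C(ℝ, X)), IsTube G x V Set.univ gauge flow := by
  obtain ⟨n, i₀, a₀, z, hz, hx⟩ := C.exists_open_cell x
  let Tube : ℕ → Type v := fun k =>
    {p : (X → ℝ) × (X → C(ℝ, X)) // IsTube G x V (C.skel (n + 1 + k)) p.1 p.2}
  have base : Nonempty (Tube 0) := by
    subst hx
    obtain ⟨ρ, h, H⟩ := exists_tube_open_cell hV i₀ a₀ z hz hxV
    exact ⟨⟨(ρ, h), H⟩⟩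
  have step : ∀ k (T : Tube k), ∃ T' : Tube (k + 1),
      (∀ y ∈ C.skel (n + 1 + k), T'.1.1 y = T.1.1 y) ∧
      ∀ y ∈ C.skel (n + 1 + k), T'.1.2 y = T.1.2 y := by
    rintro k ⟨⟨ρ, h⟩, H⟩
    obtain ⟨ρ', h', H', h1, h2⟩ := exists_tube_succ hV hVinv H
    exact ⟨⟨(ρ', h'), H'⟩, h1, h2⟩
  choose next hnext1 hnext2 using step
  let T : ∀ k, Tube k := fun k => Nat.rec base.some next k
  have hT1 : ∀ k l, k ≤ l → ∀ y ∈ C.skel (n + 1 + k), (T l).1.1 y = (T k).1.1 y := by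
    intro k l hkl y hy
    induction l, hkl using Nat.le_induction with
    | base => rfl
    | succ l hl ih => exact (hnext1 l (T l) y (C.skel_mono (by omega) hy)).trans ih
  have hT2 : ∀ k l, k ≤ l → ∀ y ∈ C.skel (n + 1 + k), (T l).1.2 y = (T k).1.2 y := by
    intro k l hkl y hy
    induction l, hkl using Nat.le_induction with
    | base => rfl
    | succ l hl ih => exact (hnext2 l (T l) y (C.skel_mono (by omega) hy)).trans ih
  have hmem : ∀ y, ∃ k, y ∈ C.skel (n + 1 + k) := by
    intro y
    obtain ⟨k, hk⟩ := C.exists_mem_skel y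
    exact ⟨k, C.skel_mono (by omega) hk⟩
  -- Values are read off at any stage whose skeleton contains the point; the stages agree, so the
  -- choice does not affect continuity.
  choose idx hidx using hmem
  let gauge : X → ℝ := fun y => (T (idx y)).1.1 y
  let flow : X → C(ℝ, X) := fun y => (T (idx y)).1.2 y
  have hg : ∀ k, ∀ y ∈ C.skel (n + 1 + k), gauge y = (T k).1.1 y := by
    intro k y hy
    rcases le_total (idx y) k with h | h
    · exact (hT1 _ _ h y (hidx y)).symm
    · exact hT1 _ _ h y hy
  have hf : ∀ k, ∀ y ∈ C.skel (n + 1 + k), flow y = (T k).1.2 y := by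
    intro k y hy
    rcases le_total (idx y) k with h | h
    · exact (hT2 _ _ h y (hidx y)).symm
    · exact hT2 _ _ h y hy
  have hcg : ContinuousOn gauge Set.univ := by
    refine C.continuousOn_of_inter_skel isClosed_univ (n + 1) fun m hm => ?_
    obtain ⟨k, rfl⟩ := Nat.exists_eq_add_of_le hm
    rw [Set.univ_inter]
    exact (T k).2.continuousOn_gauge.congr (hg k)
  have hbase : x ∈ C.skel (n + 1 + 0) := (T 0).2.base_mem
  refine ⟨gauge, flow, ?_⟩
  refine
    { base_mem := Set.mem_univ x
      gauge_base := by rw [hg 0 x hbase, (T 0).2.gauge_base]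
      flow_base := by rw [hf 0 x hbase, (T 0).2.flow_base]
      gauge_nonneg := fun y _ => (T _).2.gauge_nonneg y (hidx y)
      gauge_le_two := fun y _ => (T _).2.gauge_le_two y (hidx y)
      gauge_smul := fun g y _ => ?_
      continuousOn_gauge := hcg
      continuousOn_flow := ?_
      flow_smul := fun g y _ hy t => ?_
      flow_of_nonpos := fun y _ => (T _).2.flow_of_nonpos y (hidx y)
      flow_one := fun y _ => (T _).2.flow_one y (hidx y)
      flow_mem := fun _ _ _ _ _ _ => Set.mem_univ _
      gauge_flow_le := fun y _ hy t h0 h1 => ?_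
      flow_flow_one := fun y _ hy t h0 h1 => ?_
      mem_of_flow_one_eq := fun y _ => (T _).2.mem_of_flow_one_eq y (hidx y) }
  · rw [hg _ _ (C.smul_mem_skel g (hidx y)), (T _).2.gauge_smul g y (hidx y)]
  · refine C.continuousOn_of_inter_skel (hcg.preimage_isClosed_of_isClosed isClosed_univ
      isClosed_Iic) (n + 1) fun m hm => ?_
    obtain ⟨k, rfl⟩ := Nat.exists_eq_add_of_le hm
    refine ((T k).2.continuousOn_flow.mono ?_).congr fun y hy => hf k y hy.2
    rintro y ⟨⟨-, h⟩, hy⟩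
    refine ⟨hy, ?_⟩
    have h' : gauge y ≤ 1 := h
    rwa [hg k y hy] at h'
  · rw [hf _ _ (C.smul_mem_skel g (hidx y)), (T _).2.flow_smul g y (hidx y) hy]
  · rw [hg _ _ ((T _).2.flow_mem y (hidx y) hy t h0 h1)]
    exact (T _).2.gauge_flow_le y (hidx y) hy t h0 h1
  · rw [hf _ _ ((T _).2.flow_mem y (hidx y) hy t h0 h1)]
    exact (T _).2.flow_flow_one y (hidx y) hy t h0 h1

end GCWComplex

/-! ### The balanced product -/

section BalancedProduct

variable {G : Type u} {X : Type v} [Group G] [MulAction G X]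

/-- The map `G ×_H S → G · S`. -/
noncomputable def BalancedProduct.toSaturation {H : Subgroup G} (S : SubMulAction H X) :
    BalancedProduct H S → saturation G (S : Set X) :=
  Quotient.lift (fun p => ⟨((CompactCoherentification.mk (G × S)).symm p).1 •
      (((CompactCoherentification.mk (G × S)).symm p).2 : X), _, _, Subtype.property _, rfl⟩) <| by
    rintro p q ⟨h, h₁, h₂⟩
    refine Subtype.ext ?_
    simp only [h₁, h₂, SubMulAction.val_smul, Subgroup.smul_def]
    rw [← mul_smul, inv_mul_cancel_right]

theorem BalancedProduct.exists_mk {H : Subgroup G} {S : Type*} [MulAction H S]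
    (z : BalancedProduct H S) : ∃ g s, z = BalancedProduct.mk H g s :=
  Quotient.inductionOn z fun p => ⟨((CompactCoherentification.mk (G × S)).symm p).1,
    ((CompactCoherentification.mk (G × S)).symm p).2, rfl⟩

variable [TopologicalSpace G] [TopologicalSpace X]

theorem BalancedProduct.continuous_toSaturation [ContinuousKSMul G X] {H : Subgroup G}
    (S : SubMulAction H X) : Continuous (BalancedProduct.toSaturation S) := by
  refine Continuous.quotient_lift (Continuous.subtype_mk ?_ _) _
  exact (continuous_fst.comp CompactCoherentification.continuous_mk_symm).kSMul
    (continuous_subtype_val.comp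
      (continuous_snd.comp CompactCoherentification.continuous_mk_symm))

theorem BalancedProduct.continuous_mk {Y : Type*} [TopologicalSpace Y] [CompactlyCoherentSpace Y]
    {H : Subgroup G} {S : Type*} [TopologicalSpace S] [MulAction H S] {f : Y → G} {k : Y → S}
    (hf : Continuous f) (hk : Continuous k) :
    Continuous fun y => BalancedProduct.mk H (f y) (k y) :=
  continuous_quotient_mk'.comp (hf.prodMk hk).compactCoherentification_mk

/-- If `S` is the fiber over `1H` of an equivariant map `G · S → G ⧸ H` and `(G, H)` satisfies
Condition (S), then `G · S` is `G ×_H S`. -/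
theorem exists_balancedProduct_homeomorph [T2Space G] [CompactlyGeneratedSpace G] [IsKGroup G]
    [T2Space X] [CompactlyGeneratedSpace X] [ContinuousKSMul G X] {H : Subgroup G}
    (hH : ConditionS H) (S : SubMulAction H X)
    (hU : IsQuasiRegularOpen (saturation G (S : Set X))) (R : X → G ⧸ H)
    (hR : ContinuousOn R (saturation G (S : Set X)))
    (hRS : ∀ (g : G), ∀ s ∈ S, R (g • s) = (g : G ⧸ H))
    (hSR : ∀ y ∈ saturation G (S : Set X), ∀ g : G, R y = (g : G ⧸ H) → g⁻¹ • y ∈ S) :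
    ∃ φ : BalancedProduct H S ≃ₜ saturation G (S : Set X),
      (∀ (g : G) (s : S), (φ (BalancedProduct.mk H g s) : X) = g • (s : X)) ∧
      ∀ (g : G) (z : BalancedProduct H S), (φ (g • z) : X) = g • (φ z : X) := by
  have := IsKGroup.separatelyContinuousMul G
  have hinj : Function.Injective (BalancedProduct.toSaturation S) := by
    intro z z' h
    obtain ⟨g, s, rfl⟩ := BalancedProduct.exists_mk z
    obtain ⟨g', s', rfl⟩ := BalancedProduct.exists_mk z'
    have h1 : g • (s : X) = g' • (s' : X) := congrArg Subtype.val h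
    have h2 : (g' : G ⧸ H) = (g : G ⧸ H) := by
      rw [← hRS g s s.2, h1, hRS g' s' s'.2]
    refine Quotient.sound ⟨⟨g'⁻¹ * g, QuotientGroup.eq.1 h2⟩, ?_, ?_⟩
    · simp
    · refine Subtype.ext ?_
      change (s' : X) = (g'⁻¹ * g) • (s : X)
      rw [mul_smul, h1, inv_smul_smul]
  have hsurj : Function.Surjective (BalancedProduct.toSaturation S) := by
    rintro ⟨y, g, s, hs, rfl⟩
    exact ⟨BalancedProduct.mk H g ⟨s, hs⟩, rfl⟩
  let e := Equiv.ofBijective _ ⟨hinj, hsurj⟩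
  have he : Continuous e.symm := by
    refine continuous_iff_continuousAt.2 ?_
    rintro ⟨y₀, hy₀⟩
    obtain ⟨g₀, hg₀⟩ := QuotientGroup.mk_surjective (R y₀)
    -- Condition (S) gives a section only near `1H`; translation by `g₀` moves it near `R y₀`.
    obtain ⟨B, ⟨hBo, hBr⟩, hB1, σ, hσ, hσB⟩ := hH
    have hsmul : Continuous fun c : G ⧸ H => g₀⁻¹ • c := by
      rw [(QuotientGroup.isQuotientMap_mk H).continuous_iff]
      exact QuotientGroup.continuous_mk.comp (continuous_const_mul g₀⁻¹)
    have hR' : ContinuousOn (fun y => g₀⁻¹ • R y) (saturation G (S : Set X)) :=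
      hsmul.comp_continuousOn hR
    let N : Set X := saturation G (S : Set X) ∩ (fun y => g₀⁻¹ • R y) ⁻¹' B
    have hN : IsOpen N := hR'.isOpen_inter_preimage hU.1 hBo
    -- Continuity into the k-product is tested on a compactly generated source. Closed neighborhoods
    -- inside `N` come from quasi-regularity of both `G · S` and `B`.
    have : CompactlyGeneratedSpace N := by
      refine compactlyGeneratedSpace_subtype ?_
      rintro y ⟨hy, hyB⟩
      obtain ⟨W, hW, hyW, hWU⟩ := hU.2 y hy
      obtain ⟨W', hW', hyW', hWB⟩ := hBr _ hyB
      refine ⟨W ∩ (saturation G (S : Set X) ∩ (fun y => g₀⁻¹ • R y) ⁻¹' W'),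
        closure W ∩ (fun y => g₀⁻¹ • R y) ⁻¹' closure W',
        hW.inter (hR'.isOpen_inter_preimage hU.1 hW'), ⟨hyW, hy, hyW'⟩,
        (hR'.mono hWU).preimage_isClosed_of_isClosed isClosed_closure isClosed_closure, ?_, ?_⟩
      · exact fun z hz => ⟨hWU hz.1, hWB hz.2⟩
      · exact fun z hz => ⟨subset_closure hz.1.1, subset_closure hz.1.2.2⟩
    -- `τ` lifts `R` to `G`, so `(τ y)⁻¹ • y` lies over `1H`, that is, in `S`.
    let τ : N → G := fun y => g₀ * σ ⟨g₀⁻¹ • R y, y.2.2⟩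
    have hτ : Continuous τ := by
      refine (continuous_const_mul g₀).comp (hσ.comp (Continuous.subtype_mk ?_ _))
      exact hR'.comp_continuous continuous_subtype_val fun y => y.2.1
    have hτR : ∀ y : N, R y = (τ y : G ⧸ H) := by
      intro y
      have h := hσB ⟨g₀⁻¹ • R y, y.2.2⟩
      have h' : (τ y : G ⧸ H) = g₀ • ((σ ⟨g₀⁻¹ • R y, y.2.2⟩ : G) : G ⧸ H) := rfl
      rw [h', h, smul_inv_smul]
    let s : N → S := fun y => ⟨(τ y)⁻¹ • (y : X), hSR y y.2.1 _ (hτR y)⟩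
    have hs : Continuous s := by
      refine Continuous.subtype_mk ?_ _
      exact ((IsKGroup.continuous_inv (G := G)).comp hτ).kSMul continuous_subtype_val
    have hΨ : Continuous fun y : N => BalancedProduct.mk H (τ y) (s y) :=
      BalancedProduct.continuous_mk hτ hs
    have hes : ∀ y : N, e.symm ⟨y, y.2.1⟩ = BalancedProduct.mk H (τ y) (s y) := by
      intro y
      rw [Equiv.symm_apply_eq]
      refine Subtype.ext ?_
      change (y : X) = τ y • (τ y)⁻¹ • (y : X)
      rw [smul_inv_smul]
    have hon : ContinuousOn e.symm (Subtype.val ⁻¹' N) := by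
      rw [continuousOn_iff_continuous_domRestrict]
      refine (hΨ.comp (f := fun y : (Subtype.val ⁻¹' N : Set (saturation G (S : Set X))) =>
        (⟨y.1.1, y.2⟩ : N)) ?_).congr fun y => (hes ⟨y.1.1, y.2⟩).symm
      exact (continuous_subtype_val.comp continuous_subtype_val).subtype_mk _
    refine hon.continuousAt ((hN.preimage continuous_subtype_val).mem_nhds ⟨hy₀, ?_⟩)
    change g₀⁻¹ • R y₀ ∈ B
    rw [← hg₀, MulAction.Quotient.smul_coe, smul_eq_mul, inv_mul_cancel]
    exact hB1
  refine ⟨⟨e, BalancedProduct.continuous_toSaturation S, he⟩, fun g s => rfl, fun g z => ?_⟩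
  obtain ⟨g', s, rfl⟩ := BalancedProduct.exists_mk z
  exact mul_smul g g' (s : X)

end BalancedProduct

/-! ### The slice of a tube -/

namespace IsTube

variable {G : Type u} {X : Type v} [Group G] [TopologicalSpace X] [MulAction G X] {x : X}
  {V : Set X} {gauge : X → ℝ} {flow : X → C(ℝ, X)}

/-- The points of a tube that flow to `x`. -/
def slice (T : IsTube G x V Set.univ gauge flow) : SubMulAction (MulAction.stabilizer G x) X where
  carrier := {y | gauge y < 1 ∧ flow y 1 = x}
  smul_mem' := by
    rintro ⟨h, hh⟩ y ⟨hy, hyx⟩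
    change gauge (h • y) < 1 ∧ flow (h • y) 1 = x
    rw [T.gauge_smul h y (Set.mem_univ y), T.flow_smul h y (Set.mem_univ y) hy.le, hyx]
    exact ⟨hy, hh⟩

variable (T : IsTube G x V Set.univ gauge flow)

theorem mem_slice {y : X} : y ∈ T.slice ↔ gauge y < 1 ∧ flow y 1 = x := Iff.rfl

theorem base_mem_slice : x ∈ T.slice :=
  T.mem_slice.2 ⟨by rw [T.gauge_base]; exact one_pos, T.flow_base⟩

theorem flow_mem_slice {y : X} (hy : y ∈ T.slice) {t : ℝ} (h0 : 0 ≤ t) (h1 : t ≤ 1) :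
    flow y t ∈ T.slice := by
  obtain ⟨hy1, hyx⟩ := hy
  refine T.mem_slice.2 ⟨(T.gauge_flow_le y (Set.mem_univ y) hy1.le t h0 h1).trans_lt hy1, ?_⟩
  rw [T.flow_flow_one y (Set.mem_univ y) hy1.le t h0 h1, hyx]

theorem continuous_gauge (T : IsTube G x V Set.univ gauge flow) : Continuous gauge := continuousOn_univ.1 T.continuousOn_gauge

theorem continuousOn_flow_one (T : IsTube G x V Set.univ gauge flow) :
    ContinuousOn (fun y => flow y 1) {y | gauge y ≤ 1} := by
  have := T.continuousOn_flow
  rw [Set.univ_inter] at this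
  exact (continuous_eval_const (1 : ℝ)).comp_continuousOn this

/-- The flow is still continuous at gauge exactly 1, so these truncated fibers are closed in all of
`X`. They bound the closure of the slice and provide closed neighborhoods in it. -/
theorem isClosed_fiber [T2Space X] (T : IsTube G x V Set.univ gauge flow) {θ : ℝ} (hθ : θ ≤ 1) :
    IsClosed {y | gauge y ≤ θ ∧ flow y 1 = x} :=
  (T.continuousOn_flow_one.mono fun _ hy => le_trans hy hθ).preimage_isClosed_of_isClosed
    (isClosed_le T.continuous_gauge continuous_const) (isClosed_singleton (x := x))

theorem compactlyGeneratedSpace_slice [T2Space X] [CompactlyGeneratedSpace X] :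
    CompactlyGeneratedSpace T.slice := by
  refine compactlyGeneratedSpace_subtype (A := (T.slice : Set X)) ?_
  rintro y ⟨hy, hyx⟩
  obtain ⟨θ, h1, h2⟩ := exists_between hy
  refine ⟨{z | gauge z < θ}, {z | gauge z ≤ θ ∧ flow z 1 = x},
    isOpen_lt T.continuous_gauge continuous_const, h1, T.isClosed_fiber h2.le, ?_, ?_⟩
  · exact fun z hz => ⟨hz.1.trans_lt h2, hz.2⟩
  · exact fun z hz => ⟨le_of_lt hz.1, hz.2.2⟩

theorem closure_slice_subset [T2Space X] : closure (T.slice : Set X) ⊆ V := by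
  have h : (T.slice : Set X) ⊆ {y | gauge y ≤ 1 ∧ flow y 1 = x} := fun y hy => ⟨hy.1.le, hy.2⟩
  refine (closure_minimal h (T.isClosed_fiber le_rfl)).trans ?_
  exact fun y hy => T.mem_of_flow_one_eq y (Set.mem_univ y) hy.1 hy.2

/-- A point that flows to `g • x` is moved into the slice by `g⁻¹`. -/
theorem saturation_slice : saturation G (T.slice : Set X) = {y | gauge y < 1} := by
  ext y
  constructor
  · rintro ⟨g, s, hs, rfl⟩
    change gauge (g • s) < 1
    rw [T.gauge_smul g s (Set.mem_univ s)]
    exact hs.1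
  · intro hy
    have hy' : gauge y < 1 := hy
    obtain ⟨g, hg⟩ := T.flow_one y (Set.mem_univ y) hy'.le
    refine ⟨g, g⁻¹ • y, T.mem_slice.2 ⟨?_, ?_⟩, smul_inv_smul g y⟩
    · rwa [T.gauge_smul _ y (Set.mem_univ y)]
    · rw [T.flow_smul _ y (Set.mem_univ y) hy'.le, hg, inv_smul_smul]

theorem isQuasiRegularOpen_saturation_slice :
    IsQuasiRegularOpen (saturation G (T.slice : Set X)) := by
  rw [T.saturation_slice]
  refine ⟨isOpen_lt T.continuous_gauge continuous_const, fun y hy => ?_⟩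
  obtain ⟨θ, h1, h2⟩ := exists_between (show gauge y < 1 from hy)
  refine ⟨{z | gauge z < θ}, isOpen_lt T.continuous_gauge continuous_const, h1, ?_⟩
  exact (closure_lt_subset_le T.continuous_gauge continuous_const).trans
    fun z hz => lt_of_le_of_lt hz h2

/-- The flow contracts the slice equivariantly to the point `x`. -/
theorem isGHomotopyEquiv_pointInclusion :
    IsGHomotopyEquiv (MulAction.stabilizer G x) (pointInclusion T.slice T.base_mem_slice) := by
  have hsub : Subsingleton (stabilizerPoint G x) :=
    ⟨fun a b => Subtype.ext ((show (a : X) = x from a.2).trans (show (b : X) = x from b.2).symm)⟩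
  have hflow : Continuous fun y : T.slice => flow (y : X) :=
    T.continuousOn_flow.comp_continuous continuous_subtype_val
      fun y => ⟨Set.mem_univ _, y.2.1.le⟩
  refine ⟨fun h a => rfl, .const _ ⟨x, rfl⟩, fun h a => Subsingleton.elim _ _, ?_, ?_⟩
  · have : (ContinuousMap.const T.slice (⟨x, rfl⟩ : stabilizerPoint G x)).comp
        (pointInclusion T.slice T.base_mem_slice) = ContinuousMap.id _ :=
      ContinuousMap.ext fun a => Subsingleton.elim _ _
    rw [this]
    exact ⟨.refl _, fun t h a => rfl⟩
  -- Time is reversed because the homotopy has to start at the constant map and end at the identity.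
  · refine ⟨{ toFun := fun p => ⟨flow (p.2 : X) (1 - p.1), T.flow_mem_slice p.2.2
                (by linarith [p.1.2.2]) (by linarith [p.1.2.1])⟩
              continuous_toFun := ?_
              map_zero_left := fun a => ?_
              map_one_left := fun a => ?_ }, fun t h a => ?_⟩
    · refine Continuous.subtype_mk ?_ _
      exact ContinuousEval.continuous_eval.comp
        ((hflow.comp continuous_snd).prodMk (by fun_prop))
    · refine Subtype.ext ?_
      change flow (a : X) (1 - ((0 : unitInterval) : ℝ)) = x
      rw [Set.Icc.coe_zero, sub_zero]
      exact a.2.2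
    · refine Subtype.ext ?_
      change flow (a : X) (1 - ((1 : unitInterval) : ℝ)) = a
      rw [Set.Icc.coe_one, sub_self]
      exact T.flow_of_nonpos a (Set.mem_univ _) a.2.1.le 0 le_rfl
    · refine Subtype.ext ?_
      exact T.flow_smul (h : G) a (Set.mem_univ _) a.2.1.le _

end IsTube

/-! ### The slice theorem -/

theorem mainTheorem6 {G : Type u} {X : Type v}
    [Group G] [TopologicalSpace G] [T2Space G] [CompactlyGeneratedSpace G] [IsKGroup G]
    [TopologicalSpace X] [T2Space X] [CompactlyGeneratedSpace X]
    [MulAction G X] [ContinuousKSMul G X]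
    (C : GCWComplex.{u, v, w} G X) (x : X)
    (hS : ConditionS (MulAction.stabilizer G x))
    (V : Set X) (hV : V ∈ 𝓝 x)
    (hVinv : ∀ h ∈ MulAction.stabilizer G x, ∀ y ∈ V, h • y ∈ V) :
    ∃ (S : SubMulAction (MulAction.stabilizer G x) X) (hx : x ∈ S),
      (T2Space S ∧ CompactlyGeneratedSpace S) ∧
      closure (S : Set X) ⊆ V ∧
      IsGHomotopyEquiv (MulAction.stabilizer G x) (pointInclusion S hx) ∧
      IsQuasiRegularOpen (saturation G (S : Set X)) ∧
      (∀ (g : G), ∀ y ∈ saturation G (S : Set X), g • y ∈ saturation G (S : Set X)) ∧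
      ∃ φ : BalancedProduct (MulAction.stabilizer G x) S ≃ₜ saturation G (S : Set X),
        (∀ (g : G) (s : S),
          (φ (BalancedProduct.mk (MulAction.stabilizer G x) g s) : X) = g • (s : X)) ∧
        ∀ (g : G) (z : BalancedProduct (MulAction.stabilizer G x) S),
          (φ (g • z) : X) = g • (φ z : X) := by
  have := IsKGroup.separatelyContinuousMul G
  have := ContinuousKSMul.continuousConstSMul G X
  have hVinv' : ∀ h ∈ MulAction.stabilizer G x, ∀ y ∈ interior V, h • y ∈ interior V := by
    intro h hh y hy
    refine interior_maximal (s := V) (t := (h⁻¹ • ·) ⁻¹' interior V) ?_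
      (isOpen_interior.preimage (continuous_const_smul h⁻¹)) (by simpa using hy)
    intro z hz
    simpa using hVinv h hh _ (interior_subset hz)
  obtain ⟨gauge, flow, T⟩ := C.exists_tube x isOpen_interior (mem_interior_iff_mem_nhds.2 hV)
    hVinv'
  -- `R` is the time-one map in orbit coordinates, with a default value where the gauge exceeds 1.
  -- Its continuity uses that the orbit carries the topology of `G ⧸ G_x`.
  have hR : ∀ y, ∃ c : G ⧸ MulAction.stabilizer G x, gauge y ≤ 1 →
      MulAction.ofQuotientStabilizer G x c = flow y 1 := by
    intro y
    by_cases hy : gauge y ≤ 1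
    · obtain ⟨g, hg⟩ := T.flow_one y (Set.mem_univ y) hy
      exact ⟨g, fun _ => hg.symm⟩
    · exact ⟨((1 : G) : G ⧸ MulAction.stabilizer G x), fun h => absurd h hy⟩
  choose R hR using hR
  have hRc : ContinuousOn R {y | gauge y ≤ 1} := by
    rw [(C.isClosedEmbedding_orbit x).isInducing.continuousOn_iff]
    exact T.continuousOn_flow_one.congr fun y hy => hR y hy
  have hsat := T.saturation_slice
  refine ⟨T.slice, T.base_mem_slice, ⟨inferInstance, T.compactlyGeneratedSpace_slice⟩,
    T.closure_slice_subset.trans interior_subset, T.isGHomotopyEquiv_pointInclusion,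
    T.isQuasiRegularOpen_saturation_slice, ?_, ?_⟩
  · rintro g _ ⟨g', s, hs, rfl⟩
    exact ⟨g * g', s, hs, mul_smul g g' s⟩
  · refine exists_balancedProduct_homeomorph hS T.slice T.isQuasiRegularOpen_saturation_slice R
      (hRc.mono ?_) ?_ ?_
    · rw [hsat]
      exact fun y (hy : gauge y < 1) => hy.le
    · rintro g s ⟨hs, hsx⟩
      apply MulAction.injective_ofQuotientStabilizer G x
      have hgs : gauge (g • s) ≤ 1 := by
        rw [T.gauge_smul g s (Set.mem_univ s)]
        exact hs.le
      rw [hR _ hgs, T.flow_smul g s (Set.mem_univ s) hs.le, hsx]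
      rfl
    · intro y hy g hg
      rw [hsat] at hy
      have hy' : gauge y < 1 := hy
      refine T.mem_slice.2 ⟨?_, ?_⟩
      · rwa [T.gauge_smul _ y (Set.mem_univ y)]
      · rw [T.flow_smul _ y (Set.mem_univ y) hy'.le, ← hR y hy'.le, hg,
          MulAction.ofQuotientStabilizer_mk, inv_smul_smul]
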